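/- **Setting.** There are $K\ge 2$ arms with mean rewards $\mu_1,\dots,\mu_K$. Playing arm $a_t$ in round $t$ yields the reward $y_t=\mu_{a_t}+\epsilon_t$, where the $\epsilon_t$ are i.i.d. $N(0,\sigma^2)$ with known $\sigma^2>0$. Let $V_{K,1}$ be the set of environments $v$ with exactly one change point, that is, exactly one $x^*_v\in[K-1]$ with $\mu_{x^*_v}\ne\mu_{x^*_v+1}$; put $\Delta=|\mu_{x^*_v}-\mu_{x^*_v+1}|$. A (possibly randomised) policy $\pi$ consists of a sampling rule, a stopping time $\tau$ and a recommendation $\hat x_\tau\in[K-1]$, all based on past actions, past rewards and independent internal randomness. It is *Exact-$(1,\delta)$* if $\mathbb P_{\pi,v}(\hat x_\tau=x_v^*)>1-\delta$ and $\mathbb P_{\pi,v}(\tau<\infty)=1$ for every $v\in V_{K,1}$. Let $$c^*(v)^{-1}=\sup_{\alpha}\ \inf_{v'\in V_{K,1}:\,x^*_{v'}\neq x^*_v}\ \sum_{i=1}^K\alpha_i\,D\big(N(\mu_{v,i},\sigma^2),N(\mu_{v',i},\sigma^2)\big),$$ where $\alpha$ ranges over the probability vectors on $[K]$ and $D$ is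 the Kullback–Leibler divergence. **Algorithm CPI** (confidence level $\delta\in(0,1)$). Let $T_i(t)$ and $\hat\mu_i(t)$ be the number of plays and the empirical mean of arm $i$ after $t$ rounds, and let $\hat x_t\in\arg\max_{a\in[K-1]}|\hat\mu_a(t)-\hat\mu_{a+1}(t)|$. First play each arm once. Then, after $t\ge K$ rounds, stop and return $\hat x_t$ if $$\frac{T_{\hat x_t}(t)\,T_{\hat x_t+1}(t)}{2\sigma^2\,(T_{\hat x_t}(t)+T_{\hat x_t+1}(t))}\,\big(\hat\mu_{\hat x_t}(t)-\hat\mu_{\hat x_t+1}(t)\big)^2\ \ge\ \beta(t,\delta),$$ where $$\beta(t,\delta)=\log\frac{t\gamma(K-1)}{\delta}+8\log\log\frac{t\gamma(K-1)}{\delta},\qquad \gamma=\frac{2e^39^6}{\log 3}.$$ Otherwise, if $\min_iT_i(t)<\sqrt t$, play an arm in $\arg\min_iT_i(t)$ next; if not, play an arm in $\arg\min_{i\in\{\hat x_t,\hat x_t+1\}}T_i(t)$ next. All ties are broken arbitrarily. Let $\tau_\delta$ be the stopping time. **Theorem.** For every $\delta\in(0,1)$, CPI is an Exact-$(1,\delta)$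 policy, and for every $v\in V_{K,1}$ it satisfies $$\limsup_{\delta\to0}\frac{\mathbb E_{v}[\tau_\delta]}{\log(1/\delta)}\ \le\ \frac{8\sigma^2}{\Delta^2}.$$ If $K\ge3$, then $c^*(v)=8\sigma^2/\Delta^2$, so that $\limsup_{\delta\to0}\mathbb E_v[\tau_\delta]/\log(1/\delta)\le c^*(v)$, and CPI is asymptotically optimal: every family $(\pi_\delta)_{\delta\in(0,1)}$ of Exact-$(1,\delta)$ policies with stopping times $\tau^{\pi_\delta}$ satisfies $$\liminf_{\delta\to0}\frac{\mathbb E_{\pi_\delta,v}[\tau^{\pi_\delta}]}{\log(1/\delta)}\ \ge\ c^*(v).$$ -/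

import Mathlib

open MeasureTheory ProbabilityTheory Filter Topology
open scoped NNReal ENNReal

noncomputable section

namespace ChangePointBandit

/-! There are `K = m + 1` arms, indexed by `Fin (m + 1)`, and `m = K - 1` possible positions of a
change; position `i : Fin m` lies between the adjacent arms `i.castSucc` and `i.succ`. -/

/-- The set of change points of a vector of mean rewards. -/
def changePoints {m : ℕ} (μ : Fin (m + 1) → ℝ) : Set (Fin m) :=
  {i | μ i.castSucc ≠ μ i.succ}

/-- The class `V_{K,1}`: mean vectors with exactly one change point `cp`. -/
structure Env (m : ℕ) where
  mean : Fin (m + 1) → ℝ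
  cp : Fin m
  changePoints_eq : changePoints mean = {cp}

/-- The magnitude `Δ` of the change. -/
def Env.jump {m : ℕ} (v : Env m) : ℝ := |v.mean v.cp.castSucc - v.mean v.cp.succ|

/-- The inverse `c*(v)⁻¹` of the characteristic time: the supremum over sampling proportions `α`
in the simplex of the infimum, over one-change environments `v'` with a different change point,
of `∑ᵢ αᵢ D(v(i), v'(i))`, where `D` is the Kullback-Leibler divergence and the rewards of arm `i`
are Gaussian with variance `σ²`. -/
def invCharTime {m : ℕ} (σ : ℝ≥0) (v : Env m) : ℝ≥0∞ :=
  ⨆ α ∈ stdSimplex ℝ (Fin (m + 1)), ⨅ (v' : Env m) (_ : v'.cp ≠ v.cp),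
    ∑ i, ENNReal.ofReal (α i) *
      InformationTheory.klDiv (gaussianReal (v.mean i) (σ ^ 2)) (gaussianReal (v'.mean i) (σ ^ 2))

/-- The characteristic time `c*(v)`. -/
def charTime {m : ℕ} (σ : ℝ≥0) (v : Env m) : ℝ≥0∞ := (invCharTime σ v)⁻¹

/-- What has been observed after `t` rounds: the actions played and the rewards received. -/
abbrev Hist (m t : ℕ) : Type := Fin t → Fin (m + 1) × ℝ

/-- A (possibly randomised) policy. After `t` rounds all its decisions are measurable functions of
the observed history and of an internal random seed: the arm played next (sampling rule), whether
to halt now (stopping rule), and the current estimate of the change point (recommendation rule). -/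
structure Policy (m : ℕ) where
  act : (t : ℕ) → unitInterval → Hist m t → Fin (m + 1)
  halt : (t : ℕ) → unitInterval → Hist m t → Prop
  recommend : (t : ℕ) → unitInterval → Hist m t → Fin m
  measurable_act : ∀ t, Measurable fun p : unitInterval × Hist m t => act t p.1 p.2
  measurableSet_halt : ∀ t, MeasurableSet {p : unitInterval × Hist m t | halt t p.1 p.2}
  measurable_recommend : ∀ t, Measurable fun p : unitInterval × Hist m t => recommend t p.1 p.2

/-- Sample space: the seed of the policy and the noise sequence. -/
abbrev Sample : Type := unitInterval × (ℕ → ℝ)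

/-- The seed is uniform and independent of the noise, which is i.i.d. `N(0, σ²)`. -/
def law (σ : ℝ≥0) : Measure Sample :=
  (volume : Measure unitInterval).prod (Measure.infinitePi fun _ : ℕ => gaussianReal 0 (σ ^ 2))

namespace Policy

variable {m : ℕ}

/-- The history of the interaction of a policy with mean rewards `μ`: in each round the arm `a`
chosen by the policy yields the reward `μ a` plus fresh noise. -/
def history (π : Policy m) (μ : Fin (m + 1) → ℝ) (ω : Sample) : (t : ℕ) → Hist m t
  | 0 => Fin.elim0
  | t + 1 =>
    Fin.snoc (α := fun _ => Fin (m + 1) × ℝ) (history π μ ω t)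
      (π.act t ω.1 (history π μ ω t), μ (π.act t ω.1 (history π μ ω t)) + ω.2 t)

/-- The policy wants to halt after `t` rounds. -/
def StopsAt (π : Policy m) (v : Env m) (ω : Sample) (t : ℕ) : Prop :=
  π.halt t ω.1 (π.history v.mean ω t)

/-- The stopping time `τ`, the first `t` at which the policy wants to halt (`⊤` if there is none). -/
def stopTime (π : Policy m) (v : Env m) (ω : Sample) : ℕ∞ :=
  ⨅ (t : ℕ) (_ : π.StopsAt v ω t), (t : ℕ∞)

/-- The expected stopping time `E_{π,v}[τ]`, in `[0, ∞]`. -/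
def expectedTime (σ : ℝ≥0) (π : Policy m) (v : Env m) : ℝ≥0∞ :=
  ∫⁻ ω, (π.stopTime v ω : ℝ≥0∞) ∂(law σ)

/-- Exact-`(1, δ)` policies: in every environment with exactly one change point, the estimate
returned at the stopping time is correct with probability greater than `1 - δ`, and the policy stops
almost surely. -/
def IsExact (σ : ℝ≥0) (δ : ℝ) (π : Policy m) : Prop :=
  ∀ v : Env m,
    ENNReal.ofReal (1 - δ) < law σ {ω | ∃ t : ℕ, π.stopTime v ω = t ∧
      π.recommend t ω.1 (π.history v.mean ω t) = v.cp} ∧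
    law σ {ω | π.stopTime v ω < ⊤} = 1

end Policy

section Algorithm

variable {m t : ℕ}

/-- `T_i(t)`, the number of plays of arm `i`. -/
def pulls (h : Hist m t) (i : Fin (m + 1)) : ℕ :=
  (Finset.univ.filter fun s => (h s).1 = i).card

/-- `μ̂_i(t)`, the average of the rewards received from arm `i`. -/
def empMean (h : Hist m t) (i : Fin (m + 1)) : ℝ :=
  (∑ s ∈ Finset.univ.filter (fun s => (h s).1 = i), (h s).2) / pulls h i

/-- The size of the empirical change in mean at position `i`. -/
def empJump (h : Hist m t) (i : Fin m) : ℝ :=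
  |empMean h i.castSucc - empMean h i.succ|

/-- The stopping statistic at position `i`, normalised by the known noise variance `σ²`. -/
def stat (σ : ℝ≥0) (h : Hist m t) (i : Fin m) : ℝ :=
  (pulls h i.castSucc : ℝ) * (pulls h i.succ : ℝ) /
    (2 * (σ : ℝ) ^ 2 * ((pulls h i.castSucc : ℝ) + (pulls h i.succ : ℝ))) * empJump h i ^ 2

/-- The constant `γ` of the threshold. -/
def gammaConst : ℝ := 2 * Real.exp 3 * 9 ^ 6 / Real.log 3

/-- The threshold `β(t, δ) = log(t γ (K-1) / δ) + 8 log log(t γ (K-1) / δ)`, with `K - 1 = m`. -/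
def threshold (m t : ℕ) (δ : ℝ) : ℝ :=
  Real.log (t * gammaConst * m / δ) + 8 * Real.log (Real.log (t * gammaConst * m / δ))

/-- `π` is the algorithm CPI at confidence level `δ`, with some way of breaking ties. The estimate
`x̂_t` is `π.recommend t`. -/
structure IsCPI (σ : ℝ≥0) (δ : ℝ) (π : Policy m) : Prop where
  /-- The first `K` rounds play each arm once. -/
  init : ∀ t u (h : Hist m t), t < m + 1 → pulls h (π.act t u h) = 0
  /-- The estimate maximises the empirical change in mean. -/
  argmax : ∀ t u (h : Hist m t), m + 1 ≤ t → ∀ i, empJump h i ≤ empJump h (π.recommend t u h)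
  /-- Forced exploration: if some arm has fewer than `√t` plays, play a least played arm. -/
  explore : ∀ t u (h : Hist m t), m + 1 ≤ t → (∃ i, (pulls h i : ℝ) < √(t : ℝ)) →
    ∀ j, pulls h (π.act t u h) ≤ pulls h j
  /-- Tracking: otherwise play the less played of the two arms adjacent to the estimate. -/
  track : ∀ t u (h : Hist m t), m + 1 ≤ t → (∀ i, √(t : ℝ) ≤ (pulls h i : ℝ)) →
    (π.act t u h = (π.recommend t u h).castSucc ∨ π.act t u h = (π.recommend t u h).succ) ∧
    pulls h (π.act t u h) ≤ pulls h (π.recommend t u h).castSucc ∧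
    pulls h (π.act t u h) ≤ pulls h (π.recommend t u h).succ
  /-- Once each arm has been played, halt as soon as the statistic reaches the threshold. -/
  halt_iff : ∀ t u (h : Hist m t),
    π.halt t u h ↔ m + 1 ≤ t ∧ threshold m t δ ≤ stat σ h (π.recommend t u h)

end Algorithm

end ChangePointBandit

end

namespace ChangePointBandit

section

variable {m : ℕ}

/-! Correctness rests on a mixture martingale. At a position without a change the two adjacent arms
have equal means, so the stopping statistic is at most the sum over these arms of S² / (2σ²n), with
S the accumulated noise and n the number of plays (`stat_le`). Averaging exponential martingales
over a Gaussian parameter gives a martingale whose logarithm misses this sum only through its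
prefactors, which cost at most log (t b) with b = log (γ m / δ), and through the replacement of n by
n + 1/b. What the threshold contains beyond log (m / δ) pays for both losses
(`le_mix_of_threshold_le`). Ville's inequality at level m / δ and a union over the m - 1 wrong
positions then bound the error by (m - 1) δ / m < δ.

For the upper bound, forced exploration and a time-uniform deviation inequality show that, outside
an event of probability at most a multiple of exp (-k t^(1/4)), all empirical means are ε-accurate
from a time of order √t on. Then the estimate is the true change point, tracking splits all but
O(√t) plays evenly between its two arms, and the statistic at time t is at least (Δ - 2ε)² / (8σ²) ·
(t - O(√t)). For c > 8σ² / Δ² and small ε this exceeds the threshold as soon as t ≥ c log (1/δ) and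
t is larger than a constant free of δ. The exceptional probabilities are summable, so they add only
a constant to the expected time (`exists_stopTime_le`).

For the lower bound with K ≥ 3, moving the change elsewhere and using the midpoint of the two means
yields an alternative within Δ/2 of v on every arm (`Env.exists_near`). Each play thus has
divergence at most κ = Δ² / (8σ²), whichever arm is chosen; equal weights on the two arms at the
change guarantee κ against every alternative, so c*(v) = 1/κ. A correct answer for v is an error for
the alternative, hence rare there. A change of measure on histories of a fixed length T transfers
this to v as long as κ T stays below log (1/δ) by a fixed factor (`mul_ofReal_le_expectedTime`). -/

instance isProbabilityMeasure_law (σ : ℝ≥0) : IsProbabilityMeasure (law σ) := by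
  unfold law; infer_instance

/-- The law of the noise in a single round. -/
noncomputable abbrev noiseLaw (σ : ℝ≥0) : Measure ℝ := gaussianReal 0 (σ ^ 2)

/-! ### Measurability of histories and freshness of the noise. -/

section History

theorem measurable_snoc (t : ℕ) :
    Measurable fun p : Hist m t × (Fin (m + 1) × ℝ) =>
      (Fin.snoc (α := fun _ => Fin (m + 1) × ℝ) p.1 p.2 : Hist m (t + 1)) := by
  refine measurable_pi_iff.2 fun i => ?_
  refine Fin.lastCases ?_ (fun j => ?_) i
  · simpa using measurable_snd
  · simpa using (by fun_prop : Measurable fun p : Hist m t × (Fin (m + 1) × ℝ) => p.1 j)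

theorem measurable_init (t : ℕ) :
    Measurable fun h : Hist m (t + 1) =>
      (Fin.init (α := fun _ => Fin (m + 1) × ℝ) h : Hist m t) :=
  measurable_pi_iff.2 fun i => measurable_pi_apply (Fin.castSucc i)

variable (π : Policy m) (μ : Fin (m + 1) → ℝ)

theorem measurable_history (t : ℕ) : Measurable fun ω : Sample => π.history μ ω t := by
  induction t with
  | zero => exact measurable_const
  | succ t ih =>
    have hact : Measurable fun ω : Sample => π.act t ω.1 (π.history μ ω t) :=
      (π.measurable_act t).comp (measurable_fst.prodMk ih)
    have hμ : Measurable fun ω : Sample => μ (π.act t ω.1 (π.history μ ω t)) :=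
      (measurable_of_finite μ).comp hact
    exact (measurable_snoc t).comp (ih.prodMk (hact.prodMk
      (hμ.add ((measurable_pi_apply t).comp measurable_snd))))

theorem history_congr (u : unitInterval) {x y : ℕ → ℝ} (t : ℕ) (hxy : ∀ s < t, x s = y s) :
    π.history μ (u, x) t = π.history μ (u, y) t := by
  induction t with
  | zero => rfl
  | succ t ih =>
    simp only [Policy.history, ih fun s hs => hxy s (hs.trans t.lt_succ_self),
      hxy t t.lt_succ_self]

theorem indepFun_history_noise (σ : ℝ≥0) (u : unitInterval) (t : ℕ) :
    IndepFun (fun x : ℕ → ℝ => π.history μ (u, x) t) (fun x : ℕ → ℝ => x t)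
      (Measure.infinitePi fun _ : ℕ => noiseLaw σ) := by
  have hind : iIndepFun (fun (i : ℕ) (x : ℕ → ℝ) => x i)
      (Measure.infinitePi fun _ : ℕ => noiseLaw σ) :=
    iIndepFun_infinitePi (P := fun _ : ℕ => noiseLaw σ) (X := fun _ x => x)
      fun _ => measurable_id
  have h := hind.indepFun_finset (Finset.range t) {t} (by simp)
    fun i => measurable_pi_apply i
  -- The history before round t reads only the first t noise terms, so padding them with zeros loses
  -- nothing and exhibits it as a function of those terms.
  let ext : (Finset.range t → ℝ) → ℕ → ℝ := fun y s =>
    if hs : s ∈ Finset.range t then y ⟨s, hs⟩ else 0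
  have hext : Measurable ext := by
    refine measurable_pi_iff.2 fun s => ?_
    by_cases hs : s ∈ Finset.range t
    · simp only [ext, hs, dif_pos]
      fun_prop
    · simp only [ext, hs, dif_neg, not_false_eq_true]
      fun_prop
  have hψ : Measurable fun y : ({t} : Finset ℕ) → ℝ => y ⟨t, Finset.mem_singleton_self t⟩ :=
    measurable_pi_apply _
  have h2 := h.comp (φ := fun y => π.history μ (u, ext y) t)
    (ψ := fun y => y ⟨t, Finset.mem_singleton_self t⟩)
    ((measurable_history π μ t).comp (measurable_const.prodMk hext)) hψ
  convert h2 using 1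
  · funext x
    refine history_congr π μ u t fun s hs => ?_
    simp [ext, hs]
  · rfl

/-- The noise of a round is independent of the seed and of the history before that round. -/
theorem lintegral_history_noise (σ : ℝ≥0) (t : ℕ)
    {g : unitInterval × Hist m t × ℝ → ℝ≥0∞} (hg : Measurable g) :
    ∫⁻ ω, g (ω.1, π.history μ ω t, ω.2 t) ∂law σ =
      ∫⁻ ω, ∫⁻ x, g (ω.1, π.history μ ω t, x) ∂noiseLaw σ ∂law σ := by
  have hH := measurable_history π μ t
  have hm1 : Measurable fun ω : Sample => g (ω.1, π.history μ ω t, ω.2 t) :=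
    hg.comp (measurable_fst.prodMk (hH.prodMk ((measurable_pi_apply t).comp measurable_snd)))
  have hg2 : Measurable fun p : unitInterval × Hist m t =>
      ∫⁻ x, g (p.1, p.2, x) ∂noiseLaw σ := by
    refine Measurable.lintegral_prod_right'
      (f := fun q : (unitInterval × Hist m t) × ℝ => g (q.1.1, q.1.2, q.2)) ?_
    exact hg.comp (by fun_prop)
  have hm2 : Measurable fun ω : Sample => ∫⁻ x, g (ω.1, π.history μ ω t, x) ∂noiseLaw σ :=
    hg2.comp (measurable_fst.prodMk hH)
  unfold law
  rw [lintegral_prod _ hm1.aemeasurable, lintegral_prod _ hm2.aemeasurable]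
  refine lintegral_congr fun u => ?_
  have hHu : Measurable fun x : ℕ → ℝ => π.history μ (u, x) t :=
    hH.comp (measurable_const.prodMk measurable_id)
  have hmap := (indepFun_iff_map_prod_eq_prod_map_map hHu.aemeasurable
    (measurable_pi_apply t).aemeasurable).1 (indepFun_history_noise π μ σ u t)
  have hev : (Measure.infinitePi fun _ : ℕ => noiseLaw σ).map (fun x : ℕ → ℝ => x t) =
      noiseLaw σ := Measure.infinitePi_map_eval (fun _ : ℕ => noiseLaw σ) t
  rw [hev] at hmap
  have hgu : Measurable fun p : Hist m t × ℝ => g (u, p) :=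
    hg.comp (measurable_const.prodMk measurable_id)
  rw [← lintegral_map (f := fun p : Hist m t × ℝ => g (u, p)) hgu
    (hHu.prodMk (measurable_pi_apply t)), hmap, lintegral_prod _ hgu.aemeasurable,
    lintegral_map _ hHu]
  exact hgu.lintegral_prod_right'

/-- The expectation of a functional of the history after one more round. -/
theorem lintegral_history_succ (σ : ℝ≥0) (t : ℕ)
    {F : unitInterval × Hist m (t + 1) → ℝ≥0∞} (hF : Measurable F) :
    ∫⁻ ω, F (ω.1, π.history μ ω (t + 1)) ∂law σ =
      ∫⁻ ω, ∫⁻ x, F (ω.1, Fin.snoc (α := fun _ => Fin (m + 1) × ℝ) (π.history μ ω t)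
        (π.act t ω.1 (π.history μ ω t), μ (π.act t ω.1 (π.history μ ω t)) + x))
        ∂noiseLaw σ ∂law σ := by
  have hact : Measurable fun p : unitInterval × Hist m t × ℝ => π.act t p.1 p.2.1 :=
    (π.measurable_act t).comp
      (by fun_prop : Measurable fun p : unitInterval × Hist m t × ℝ => (p.1, p.2.1))
  have hμ : Measurable fun p : unitInterval × Hist m t × ℝ => μ (π.act t p.1 p.2.1) :=
    (measurable_of_finite μ).comp hact
  refine lintegral_history_noise π μ σ t (g := fun p => F (p.1,
    Fin.snoc (α := fun _ => Fin (m + 1) × ℝ) p.2.1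
      (π.act t p.1 p.2.1, μ (π.act t p.1 p.2.1) + p.2.2))) ?_
  refine hF.comp (measurable_fst.prodMk ((measurable_snoc t).comp
    (f := fun p : unitInterval × Hist m t × ℝ => (p.2.1, _)) ?_))
  exact (by fun_prop : Measurable fun p : unitInterval × Hist m t × ℝ => p.2.1).prodMk
    (hact.prodMk (hμ.add (by fun_prop)))

end History

/-! ### Numbers of plays and accumulated noise. -/

section Counts

/-- The sum of the noise terms in the rewards received from arm `i`, if the mean rewards are `μ`. -/
noncomputable def noiseSum {t : ℕ} (μ : Fin (m + 1) → ℝ) (h : Hist m t) (i : Fin (m + 1)) : ℝ :=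
  ∑ s ∈ Finset.univ.filter (fun s => (h s).1 = i), ((h s).2 - μ i)

variable {t : ℕ}

theorem pulls_eq_sum (h : Hist m t) (i : Fin (m + 1)) :
    pulls h i = ∑ s, if (h s).1 = i then 1 else 0 := by
  simp [pulls]

theorem noiseSum_eq_sum (μ : Fin (m + 1) → ℝ) (h : Hist m t) (i : Fin (m + 1)) :
    noiseSum μ h i = ∑ s, if (h s).1 = i then (h s).2 - μ i else 0 := by
  rw [noiseSum, Finset.sum_filter]

@[simp]
theorem pulls_zero (h : Hist m 0) (i : Fin (m + 1)) : pulls h i = 0 := by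
  simp [pulls_eq_sum]

@[simp]
theorem noiseSum_zero (μ : Fin (m + 1) → ℝ) (h : Hist m 0) (i : Fin (m + 1)) :
    noiseSum μ h i = 0 := by
  simp [noiseSum_eq_sum]

theorem pulls_snoc (h : Hist m t) (p : Fin (m + 1) × ℝ) (i : Fin (m + 1)) :
    pulls (Fin.snoc (α := fun _ => Fin (m + 1) × ℝ) h p : Hist m (t + 1)) i =
      pulls h i + if p.1 = i then 1 else 0 := by
  rw [pulls_eq_sum, pulls_eq_sum, Fin.sum_univ_castSucc]
  simp

theorem noiseSum_snoc (μ : Fin (m + 1) → ℝ) (h : Hist m t) (p : Fin (m + 1) × ℝ)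
    (i : Fin (m + 1)) :
    noiseSum μ (Fin.snoc (α := fun _ => Fin (m + 1) × ℝ) h p : Hist m (t + 1)) i =
      noiseSum μ h i + if p.1 = i then p.2 - μ i else 0 := by
  simp [noiseSum_eq_sum, Fin.sum_univ_castSucc]

theorem sum_pulls (h : Hist m t) : ∑ i, pulls h i = t := by
  simp_rw [pulls_eq_sum]
  rw [Finset.sum_comm]
  simp

theorem empMean_eq (μ : Fin (m + 1) → ℝ) (h : Hist m t) (i : Fin (m + 1))
    (hi : pulls h i ≠ 0) : empMean h i = μ i + noiseSum μ h i / pulls h i := by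
  have hi' : (pulls h i : ℝ) ≠ 0 := by exact_mod_cast hi
  rw [empMean, noiseSum, Finset.sum_sub_distrib, Finset.sum_const, nsmul_eq_mul]
  change _ = μ i + (_ - (pulls h i : ℝ) * μ i) / pulls h i
  field_simp
  ring

theorem measurable_pulls (i : Fin (m + 1)) : Measurable fun h : Hist m t => pulls h i := by
  simp_rw [pulls_eq_sum]
  refine Finset.measurable_sum _ fun s _ => ?_
  exact Measurable.ite ((measurable_fst.comp (measurable_pi_apply s)) (measurableSet_singleton i))
    measurable_const measurable_const

theorem measurable_noiseSum (μ : Fin (m + 1) → ℝ) (i : Fin (m + 1)) :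
    Measurable fun h : Hist m t => noiseSum μ h i := by
  simp_rw [noiseSum_eq_sum]
  refine Finset.measurable_sum _ fun s _ => ?_
  exact Measurable.ite ((measurable_fst.comp (measurable_pi_apply s)) (measurableSet_singleton i))
    ((measurable_snd.comp (measurable_pi_apply s)).sub_const _) measurable_const

end Counts

end

/-! ### Supermartingales along histories and Ville's inequality. -/

section

variable {m : ℕ}

/-- A functional of the history that, under the mean rewards `μ`, is a nonnegative supermartingale
whichever arms are played. -/
structure IsSupermart (σ : ℝ≥0) (μ : Fin (m + 1) → ℝ) (F : (t : ℕ) → Hist m t → ℝ≥0∞) :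
    Prop where
  measurable : ∀ t, Measurable (F t)
  step : ∀ t (h : Hist m t) (a : Fin (m + 1)),
    ∫⁻ x, F (t + 1) (Fin.snoc (α := fun _ => Fin (m + 1) × ℝ) h (a, μ a + x)) ∂noiseLaw σ ≤ F t h

/-- The functional `F` has reached the level `a` at or before the end of the history. -/
def Crossed (F : (t : ℕ) → Hist m t → ℝ≥0∞) (a : ℝ≥0∞) : (t : ℕ) → Hist m t → Prop
  | 0, h => a ≤ F 0 h
  | t + 1, h => Crossed F a t (Fin.init (α := fun _ => Fin (m + 1) × ℝ) h) ∨ a ≤ F (t + 1) h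

theorem measurableSet_crossed {F : (t : ℕ) → Hist m t → ℝ≥0∞} (hF : ∀ t, Measurable (F t))
    (a : ℝ≥0∞) (t : ℕ) : MeasurableSet {h : Hist m t | Crossed F a t h} := by
  induction t with
  | zero => exact measurableSet_le measurable_const (hF 0)
  | succ t ih =>
    exact (measurable_init t ih).union (measurableSet_le measurable_const (hF (t + 1)))

theorem crossed_of_le {F : (t : ℕ) → Hist m t → ℝ≥0∞} {a : ℝ≥0∞} {t : ℕ} {h : Hist m t}
    (hF : a ≤ F t h) : Crossed F a t h := by
  cases t with
  | zero => exact hF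
  | succ t => exact Or.inr hF

open Classical in
/-- The functional `F`, frozen at the level `a` once it has reached it. -/
noncomputable def frozenAt (F : (t : ℕ) → Hist m t → ℝ≥0∞) (a : ℝ≥0∞) (t : ℕ) (h : Hist m t) :
    ℝ≥0∞ :=
  if Crossed F a t h then a else F t h

namespace IsSupermart

variable {σ : ℝ≥0} {μ : Fin (m + 1) → ℝ} {F : (t : ℕ) → Hist m t → ℝ≥0∞}

/-- Before a crossing, freezing can only lower the next value, because a value that crosses is at
least `a`; after a crossing nothing moves. -/
theorem frozen (hF : IsSupermart σ μ F) (a : ℝ≥0∞) : IsSupermart σ μ (frozenAt F a) := by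
  refine ⟨fun t => Measurable.ite (measurableSet_crossed hF.measurable a t) measurable_const
    (hF.measurable t), fun t h b => ?_⟩
  by_cases hc : Crossed F a t h
  · have : ∀ x, frozenAt F a (t + 1)
        (Fin.snoc (α := fun _ => Fin (m + 1) × ℝ) h (b, μ b + x)) = a := fun x =>
      if_pos (Or.inl (by simpa using hc))
    simp only [this]
    simp [frozenAt, hc]
  · refine (lintegral_mono fun x => ?_).trans ((hF.step t h b).trans_eq ?_)
    · unfold frozenAt
      split_ifs with hx
      · rcases hx with hx | hx
        · exact absurd (by simpa using hx) hc
        · exact hx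
      · exact le_rfl
    · simp [frozenAt, hc]

/-- The one-step inequality holds for every history and every arm, so it survives an adaptive and
randomised choice of the arm. -/
theorem lintegral_le (hF : IsSupermart σ μ F) {C : ℝ≥0∞} (h0 : ∀ h, F 0 h ≤ C) (π : Policy m)
    (t : ℕ) : ∫⁻ ω, F t (π.history μ ω t) ∂law σ ≤ C := by
  induction t with
  | zero => exact (lintegral_mono fun ω => h0 _).trans (by simp)
  | succ t ih =>
    rw [lintegral_history_succ π μ σ t (F := fun p => F (t + 1) p.2)
      ((hF.measurable _).comp measurable_snd)]
    exact (lintegral_mono fun ω => hF.step t _ _).trans ih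

/-- Ville's inequality. -/
theorem ville (hF : IsSupermart σ μ F) (h0 : ∀ h, F 0 h ≤ 1) (π : Policy m) (a : ℝ≥0∞) :
    law σ {ω | ∃ t, a ≤ F t (π.history μ ω t)} ≤ a⁻¹ := by
  have hinit : ∀ (ω : Sample) (t : ℕ), Fin.init (α := fun _ => Fin (m + 1) × ℝ)
      (π.history μ ω (t + 1)) = π.history μ ω t := fun ω t => by
    simp [Policy.history]
  let A : ℕ → Set Sample := fun t => {ω | Crossed F a t (π.history μ ω t)}
  have hmono : Monotone A := monotone_nat_of_le_succ fun t ω hω =>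
    Or.inl (by rw [hinit]; exact hω)
  have hA : ∀ t, law σ (A t) ≤ a⁻¹ := fun t => by
    have h1 : a * law σ (A t) ≤ 1 := by
      calc a * law σ (A t)
          ≤ a * law σ {ω | a ≤ frozenAt F a t (π.history μ ω t)} := by
            gcongr
            intro ω hω
            have hω' : Crossed F a t (π.history μ ω t) := hω
            simp [frozenAt, hω']
        _ ≤ ∫⁻ ω, frozenAt F a t (π.history μ ω t) ∂law σ :=
            mul_meas_ge_le_lintegral
              (((hF.frozen a).measurable t).comp (measurable_history π μ t)) a
        _ ≤ 1 := by
            refine (hF.frozen a).lintegral_le (fun h => ?_) π t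
            unfold frozenAt
            split_ifs with hc
            · exact hc.trans (h0 h)
            · exact h0 h
    rw [ENNReal.le_inv_iff_mul_le, mul_comm]
    exact h1
  calc law σ {ω | ∃ t, a ≤ F t (π.history μ ω t)}
      ≤ law σ (⋃ t, A t) := by
        refine measure_mono fun ω hω => ?_
        obtain ⟨t, ht⟩ := hω
        exact Set.mem_iUnion.2 ⟨t, crossed_of_le ht⟩
    _ = ⨆ t, law σ (A t) := hmono.measure_iUnion
    _ ≤ a⁻¹ := iSup_le hA

/-- A product over the arms of functionals of the number of plays and of the accumulated noise. -/
theorem prod {ψ : Fin (m + 1) → ℕ → ℝ → ℝ≥0∞} (hψ : ∀ i n, Measurable (ψ i n))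
    (hstep : ∀ i n s, ∫⁻ x, ψ i (n + 1) (s + x) ∂noiseLaw σ ≤ ψ i n s) :
    IsSupermart σ μ fun _ h => ∏ i, ψ i (pulls h i) (noiseSum μ h i) := by
  have hψ2 : ∀ i, Measurable fun p : ℕ × ℝ => ψ i p.1 p.2 := fun i =>
    measurable_from_prod_countable_right fun n => hψ i n
  refine ⟨fun t => Finset.measurable_prod _ fun i _ =>
    (hψ2 i).comp ((measurable_pulls i).prodMk (measurable_noiseSum μ i)), fun t h a => ?_⟩
  -- Only the factor of the played arm changes in a round.
  have key : ∀ x, ∏ i, ψ i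
      (pulls (Fin.snoc (α := fun _ => Fin (m + 1) × ℝ) h (a, μ a + x) : Hist m (t + 1)) i)
      (noiseSum μ (Fin.snoc (α := fun _ => Fin (m + 1) × ℝ) h (a, μ a + x) : Hist m (t + 1)) i) =
      ψ a (pulls h a + 1) (noiseSum μ h a + x) *
        ∏ i ∈ Finset.univ.erase a, ψ i (pulls h i) (noiseSum μ h i) := fun x => by
    rw [← Finset.mul_prod_erase _ _ (Finset.mem_univ a)]
    congr 1
    · simp [pulls_snoc, noiseSum_snoc]
    · refine Finset.prod_congr rfl fun i hi => ?_
      have hne : a ≠ i := (Finset.ne_of_mem_erase hi).symm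
      simp [pulls_snoc, noiseSum_snoc, hne]
  simp_rw [key]
  have hm : Measurable fun x => ψ a (pulls h a + 1) (noiseSum μ h a + x) :=
    (hψ a _).comp (measurable_const.add measurable_id)
  rw [lintegral_mul_const _ hm,
    ← Finset.mul_prod_erase _ _ (Finset.mem_univ a)]
  gcongr
  exact hstep a _ _

end IsSupermart

/-! ### Exponential and mixture martingales of Gaussian noise. -/

section Gaussian

variable {σ : ℝ≥0}

theorem lintegral_exp_mul_noiseLaw (l : ℝ) :
    ∫⁻ x, ENNReal.ofReal (Real.exp (l * x)) ∂noiseLaw σ =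
      ENNReal.ofReal (Real.exp ((σ : ℝ) ^ 2 * l ^ 2 / 2)) := by
  rw [← ofReal_integral_eq_lintegral_ofReal (integrable_exp_mul_gaussianReal l)
    (ae_of_all _ fun x => (Real.exp_pos _).le)]
  have := congrFun (mgf_fun_id_gaussianReal (μ := 0) (v := σ ^ 2)) l
  simp only [mgf] at this
  rw [this]
  simp

/-- The exponential martingale of Gaussian noise. -/
noncomputable def expWeight (σ : ℝ≥0) (l : ℝ) (n : ℕ) (s : ℝ) : ℝ≥0∞ :=
  ENNReal.ofReal (Real.exp (l * s - n * (l ^ 2 * (σ : ℝ) ^ 2 / 2)))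

theorem measurable_expWeight (l : ℝ) (n : ℕ) : Measurable (expWeight σ l n) := by
  unfold expWeight
  fun_prop

theorem lintegral_expWeight (l : ℝ) (n : ℕ) (s : ℝ) :
    ∫⁻ x, expWeight σ l (n + 1) (s + x) ∂noiseLaw σ = expWeight σ l n s := by
  have key : ∀ x, expWeight σ l (n + 1) (s + x) =
      ENNReal.ofReal (Real.exp (l * s - (n + 1) * (l ^ 2 * (σ : ℝ) ^ 2 / 2))) *
        ENNReal.ofReal (Real.exp (l * x)) := fun x => by
    rw [expWeight, ← ENNReal.ofReal_mul (Real.exp_pos _).le, ← Real.exp_add]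
    congr 2
    push_cast
    ring
  simp_rw [key]
  rw [lintegral_const_mul _ (by fun_prop), lintegral_exp_mul_noiseLaw, expWeight,
    ← ENNReal.ofReal_mul (Real.exp_pos _).le, ← Real.exp_add]
  congr 2
  ring

/-- The mixture of exponential martingales over a centred Gaussian parameter; `c` is the ratio of
the variance of the noise to that of its mean under the mixture. -/
noncomputable def mixWeight (σ : ℝ≥0) (c : ℝ) (n : ℕ) (s : ℝ) : ℝ≥0∞ :=
  ENNReal.ofReal (√(c / (n + c)) * Real.exp (s ^ 2 / (2 * (σ : ℝ) ^ 2 * (n + c))))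

theorem measurable_mixWeight (c : ℝ) (n : ℕ) : Measurable (mixWeight σ c n) := by
  unfold mixWeight
  fun_prop

/-- Completing the square: the noise density times the next weight equals the present weight times
the posterior predictive density N(s / N, σ² (N + 1) / N), where N = n + c, and the latter
integrates to one. -/
theorem lintegral_mixWeight (hσ : 0 < σ) {c : ℝ} (hc : 0 < c) (n : ℕ) (s : ℝ) :
    ∫⁻ x, mixWeight σ c (n + 1) (s + x) ∂noiseLaw σ = mixWeight σ c n s := by
  have hσ' : (0 : ℝ) < σ := hσ
  have hv : σ ^ 2 ≠ 0 := by positivity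
  set N : ℝ := n + c with hN
  have hN0 : 0 < N := by positivity
  set w : ℝ≥0 := σ ^ 2 * (Real.toNNReal ((N + 1) / N)) with hw
  have hwr : (w : ℝ) = (σ : ℝ) ^ 2 * ((N + 1) / N) := by
    rw [hw]
    push_cast
    rw [Real.coe_toNNReal _ (by positivity)]
  have hw0 : w ≠ 0 := by
    rw [← NNReal.coe_ne_zero, hwr]
    positivity
  have key : ∀ x, gaussianPDF 0 (σ ^ 2) x * mixWeight σ c (n + 1) (s + x) =
      mixWeight σ c n s * gaussianPDF (s / N) w x := fun x => by
    rw [gaussianPDF, gaussianPDF, mixWeight, mixWeight,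
      ← ENNReal.ofReal_mul (gaussianPDFReal_nonneg _ _ _), ← ENNReal.ofReal_mul (by positivity)]
    congr 1
    rw [gaussianPDFReal, gaussianPDFReal, hwr]
    have e1 : ((n + 1 : ℕ) : ℝ) + c = N + 1 := by push_cast; ring
    rw [e1, ← hN]
    have e2 : (√(2 * Real.pi * ((σ ^ 2 : ℝ≥0) : ℝ)))⁻¹ * √(c / (N + 1)) =
        √(c / N) * (√(2 * Real.pi * ((σ : ℝ) ^ 2 * ((N + 1) / N))))⁻¹ := by
      rw [← Real.sqrt_inv, ← Real.sqrt_inv, ← Real.sqrt_mul (by positivity),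
        ← Real.sqrt_mul (by positivity)]
      congr 1
      push_cast
      field_simp
    have e3 : Real.exp (-(x - 0) ^ 2 / (2 * ((σ ^ 2 : ℝ≥0) : ℝ))) *
        Real.exp ((s + x) ^ 2 / (2 * (σ : ℝ) ^ 2 * (N + 1))) =
        Real.exp (s ^ 2 / (2 * (σ : ℝ) ^ 2 * N)) *
        Real.exp (-(x - s / N) ^ 2 / (2 * ((σ : ℝ) ^ 2 * ((N + 1) / N)))) := by
      rw [← Real.exp_add, ← Real.exp_add]
      congr 1
      push_cast
      field_simp
      ring
    calc _ = ((√(2 * Real.pi * ((σ ^ 2 : ℝ≥0) : ℝ)))⁻¹ * √(c / (N + 1))) *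
          (Real.exp (-(x - 0) ^ 2 / (2 * ((σ ^ 2 : ℝ≥0) : ℝ))) *
            Real.exp ((s + x) ^ 2 / (2 * (σ : ℝ) ^ 2 * (N + 1)))) := by ring
      _ = _ := by rw [e2, e3]; ring
  have hm : Measurable fun x => mixWeight σ c (n + 1) (s + x) :=
    (measurable_mixWeight c _).comp (by fun_prop)
  rw [noiseLaw, gaussianReal_of_var_ne_zero _ hv, lintegral_withDensity_eq_lintegral_mul _
    (measurable_gaussianPDF _ _) hm]
  simp only [Pi.mul_apply, key]
  rw [lintegral_const_mul _ (measurable_gaussianPDF _ _), lintegral_gaussianPDF_eq_one _ hw0,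
    mul_one]

end Gaussian

end

/-! ### Time-uniform deviations of empirical means. -/

section

variable {m : ℕ} {σ : ℝ≥0} {μ : Fin (m + 1) → ℝ}

theorem IsSupermart.prod_finset {w : ℕ → ℝ → ℝ≥0∞} (hw : ∀ n, Measurable (w n))
    (hstep : ∀ n s, ∫⁻ x, w (n + 1) (s + x) ∂noiseLaw σ ≤ w n s) (J : Finset (Fin (m + 1))) :
    IsSupermart σ μ fun _ h => ∏ i ∈ J, w (pulls h i) (noiseSum μ h i) := by
  have h := IsSupermart.prod (σ := σ) (μ := μ) (ψ := fun i n s => if i ∈ J then w n s else 1)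
    (fun i n => by by_cases hi : i ∈ J <;> simp [hi, hw n])
    (fun i n s => by by_cases hi : i ∈ J <;> simp [hi, hstep n s])
  simpa only [Finset.prod_ite_mem, Finset.univ_inter] using h

/-- Time-uniform deviation bound for the empirical mean of an arm, in one direction. -/
theorem law_deviation_le_one_sided (π : Policy m) {l : ℝ} (hσ : 0 < σ) (hl : l ≠ 0)
    (i : Fin (m + 1)) (n : ℕ) :
    law σ {ω | ∃ t, n ≤ pulls (π.history μ ω t) i ∧
      l ^ 2 * pulls (π.history μ ω t) i ≤ l * noiseSum μ (π.history μ ω t) i} ≤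
      ENNReal.ofReal (Real.exp (-(l ^ 2 / (2 * (σ : ℝ) ^ 2) * n))) := by
  have hσ' : (0 : ℝ) < σ := hσ
  -- The tilt l / σ² is the optimal one for a deviation l. On the event it makes the exponent at
  -- least l² / (2σ²) per play, so n plays suffice and no union over times is needed.
  have hF := IsSupermart.prod_finset (μ := μ) (measurable_expWeight (σ := σ) (l / (σ : ℝ) ^ 2))
    (fun n s => (lintegral_expWeight _ n s).le) {i}
  have hv := hF.ville (fun h => by simp [expWeight]) π
    (ENNReal.ofReal (Real.exp (l ^ 2 / (2 * (σ : ℝ) ^ 2) * n)))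
  rw [← ENNReal.ofReal_inv_of_pos (Real.exp_pos _), ← Real.exp_neg] at hv
  refine (measure_mono fun ω hω => ?_).trans hv
  obtain ⟨t, h1, h2⟩ := hω
  refine ⟨t, ?_⟩
  simp only [Finset.prod_singleton, expWeight]
  gcongr
  set p : ℝ := (pulls (π.history μ ω t) i : ℝ)
  set s := noiseSum μ (π.history μ ω t) i
  have h1' : (n : ℝ) ≤ p := Nat.cast_le.2 h1
  calc l ^ 2 / (2 * (σ : ℝ) ^ 2) * n ≤ l ^ 2 / (2 * (σ : ℝ) ^ 2) * p := by gcongr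
    _ = (l ^ 2 * p) / (σ : ℝ) ^ 2 - p * ((l / (σ : ℝ) ^ 2) ^ 2 * (σ : ℝ) ^ 2 / 2) := by
        field_simp
        ring
    _ ≤ (l * s) / (σ : ℝ) ^ 2 - p * ((l / (σ : ℝ) ^ 2) ^ 2 * (σ : ℝ) ^ 2 / 2) := by gcongr
    _ = _ := by ring

/-- The event that at some time some arm has been played at least `n` times and its empirical mean
is off by at least `ε`. -/
def deviationEvent (π : Policy m) (μ : Fin (m + 1) → ℝ) (ε : ℝ) (n : ℕ) : Set Sample :=
  {ω | ∃ t i, n ≤ pulls (π.history μ ω t) i ∧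
    ε * pulls (π.history μ ω t) i ≤ |noiseSum μ (π.history μ ω t) i|}

theorem law_deviationEvent_le (π : Policy m) {ε : ℝ} (hσ : 0 < σ) (hε : 0 < ε) (n : ℕ) :
    law σ (deviationEvent π μ ε n) ≤
      (2 * (m + 1) : ℕ) * ENNReal.ofReal (Real.exp (-(ε ^ 2 / (2 * (σ : ℝ) ^ 2) * n))) := by
  let B : Bool × Fin (m + 1) → Set Sample := fun b => {ω | ∃ t, n ≤ pulls (π.history μ ω t) b.2 ∧
      (bif b.1 then ε else -ε) ^ 2 * pulls (π.history μ ω t) b.2 ≤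
        (bif b.1 then ε else -ε) * noiseSum μ (π.history μ ω t) b.2}
  have hsub : deviationEvent π μ ε n ⊆ ⋃ b ∈ (Finset.univ : Finset (Bool × Fin (m + 1))), B b := by
    rintro ω ⟨t, i, h1, h2⟩
    simp only [Finset.mem_univ, Set.iUnion_true, Set.mem_iUnion]
    have h3 := mul_le_mul_of_nonneg_left h2 hε.le
    rcases abs_cases (noiseSum μ (π.history μ ω t) i) with ⟨h, -⟩ | ⟨h, -⟩ <;> rw [h] at h3
    · refine ⟨(true, i), t, h1, ?_⟩
      simp only [cond_true]
      linarith
    · refine ⟨(false, i), t, h1, ?_⟩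
      simp only [cond_false]
      linarith
  have hB : ∀ b ∈ (Finset.univ : Finset (Bool × Fin (m + 1))), law σ (B b) ≤
      ENNReal.ofReal (Real.exp (-(ε ^ 2 / (2 * (σ : ℝ) ^ 2) * n))) := by
    rintro ⟨b, i⟩ -
    have := law_deviation_le_one_sided (μ := μ) π (l := bif b then ε else -ε) hσ
      (by cases b <;> simp [hε.ne']) i n
    have hsq : (bif b then ε else -ε) ^ 2 = ε ^ 2 := by cases b <;> simp
    simp only [hsq] at this
    simpa only [B, hsq] using this
  calc law σ (deviationEvent π μ ε n)
      ≤ ∑ b : Bool × Fin (m + 1), law σ (B b) :=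
        (measure_mono hsub).trans (measure_biUnion_finset_le _ _)
    _ ≤ ∑ _b : Bool × Fin (m + 1), ENNReal.ofReal (Real.exp (-(ε ^ 2 / (2 * (σ : ℝ) ^ 2) * n))) :=
        Finset.sum_le_sum hB
    _ = _ := by simp

/-! ### Calibration of the threshold against the mixture martingale. -/

section Threshold

/-- Apart from positivity, this is all that the argument uses about the value of γ. -/
theorem sixteen_le_log_gammaConst : 16 ≤ Real.log gammaConst := by
  have hlog3 : 0 < Real.log 3 := Real.log_pos (by norm_num)
  have hlog3' : Real.log 3 ≤ 2 := by
    have := Real.log_le_sub_one_of_pos (show (0 : ℝ) < 3 by norm_num)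
    linarith
  have he := Real.exp_one_lt_d9
  have he' := Real.exp_one_gt_d9
  have e3 : Real.exp 3 = Real.exp 1 ^ 3 := by rw [← Real.exp_nat_mul]; norm_num
  have e16 : Real.exp 16 = Real.exp 1 ^ 16 := by rw [← Real.exp_nat_mul]; norm_num
  have h3 : (20 : ℝ) ≤ Real.exp 3 := by
    rw [e3]
    calc (20 : ℝ) ≤ 2.718 ^ 3 := by norm_num
      _ ≤ _ := by gcongr; linarith
  have h16 : Real.exp 16 ≤ 20 * 9 ^ 6 := by
    rw [e16]
    calc _ ≤ (2.7183 : ℝ) ^ 16 := by gcongr; linarith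
      _ ≤ _ := by norm_num
  have hle : Real.exp 16 ≤ gammaConst := by
    rw [gammaConst, le_div_iff₀ hlog3]
    nlinarith
  exact (Real.le_log_iff_exp_le (lt_of_lt_of_le (Real.exp_pos _) hle)).2 hle

theorem gammaConst_pos : 0 < gammaConst := by
  have hlog3 : 0 < Real.log 3 := Real.log_pos (by norm_num)
  unfold gammaConst
  positivity

theorem two_le_log {x : ℝ} (hx : 16 ≤ x) : 2 ≤ Real.log x := by
  rw [Real.le_log_iff_exp_le (by linarith)]
  have he := Real.exp_one_lt_d9
  have e2 : Real.exp 2 = Real.exp 1 ^ 2 := by rw [← Real.exp_nat_mul]; norm_num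
  rw [e2]
  calc _ ≤ (4 : ℝ) ^ 2 := by gcongr; linarith
    _ ≤ x := by linarith

/-- The part `log (γ (K - 1) / δ)` of the threshold that does not depend on time. -/
noncomputable def baseLevel (m : ℕ) (δ : ℝ) : ℝ := Real.log (gammaConst * m / δ)

theorem baseLevel_eq (hm : 0 < m) {δ : ℝ} (hδ : 0 < δ) :
    baseLevel m δ = Real.log gammaConst + Real.log (m / δ) := by
  have hm' : (0 : ℝ) < m := by exact_mod_cast hm
  rw [baseLevel, mul_div_assoc, Real.log_mul gammaConst_pos.ne' (by positivity)]

theorem log_div_nonneg (hm : 0 < m) {δ : ℝ} (hδ : 0 < δ) (hδ1 : δ < 1) :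
    0 ≤ Real.log (m / δ) := by
  have hm' : (1 : ℝ) ≤ m := by exact_mod_cast hm
  refine Real.log_nonneg ?_
  rw [le_div_iff₀ hδ]
  linarith

theorem sixteen_le_baseLevel (hm : 0 < m) {δ : ℝ} (hδ : 0 < δ) (hδ1 : δ < 1) :
    16 ≤ baseLevel m δ := by
  rw [baseLevel_eq hm hδ]
  linarith [sixteen_le_log_gammaConst, log_div_nonneg hm hδ hδ1]

theorem threshold_eq (hm : 0 < m) {t : ℕ} (ht : 0 < t) {δ : ℝ} (hδ : 0 < δ) :
    threshold m t δ = Real.log t + baseLevel m δ +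
      8 * Real.log (Real.log t + baseLevel m δ) := by
  have hm' : (0 : ℝ) < m := by exact_mod_cast hm
  have ht' : (0 : ℝ) < t := by exact_mod_cast ht
  have := gammaConst_pos
  have h : Real.log (t * gammaConst * m / δ) = Real.log t + baseLevel m δ := by
    rw [baseLevel, ← Real.log_mul ht'.ne' (by positivity)]
    congr 1
    ring
  rw [threshold, h]

/-- With T = log t and g = log γ, the left side is the loss of the mixture, log b from the
prefactors and β / (b k) from enlarging the counts; the right side is the slack of the threshold.
The quotient is at most 3 + 24 = 27, as T + b ≤ 3 b k and log (T + b) ≤ T + b, while the slack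
exceeds log b by at least 7 · 2 + 16 = 30. -/
theorem threshold_budget {b T k g : ℝ} (hb : 16 ≤ b) (hT : 0 ≤ T) (hk : 1 ≤ k)
    (hTk : T ≤ 2 * b * k) (hg : 16 ≤ g) :
    Real.log b + (T + b + 8 * Real.log (T + b)) / (b * k) ≤ 8 * Real.log (T + b) + g := by
  have h1 : Real.log b ≤ Real.log (T + b) := Real.log_le_log (by linarith) (by linarith)
  have h2 := two_le_log (x := T + b) (by linarith)
  have h3 : Real.log (T + b) ≤ T + b := (Real.log_le_sub_one_of_pos (by linarith)).trans (by linarith)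
  have h4 : (T + b + 8 * Real.log (T + b)) / (b * k) ≤ 27 := by
    rw [div_le_iff₀ (by positivity)]
    nlinarith
  linarith

/-- A stopping statistic above the threshold makes the mixture martingale large. -/
theorem le_mix_of_threshold_le (hm : 0 < m) {δ : ℝ} (hδ : 0 < δ) (hδ1 : δ < 1) {t : ℕ}
    (ht : 0 < t) {k p q z₁ z₂ : ℝ} (hk : 1 ≤ k) (hkp : k ≤ p) (hkq : k ≤ q) (hpt : p + 1 ≤ t)
    (hqt : q + 1 ≤ t) (hz₁ : 0 ≤ z₁) (hz₂ : 0 ≤ z₂) (htk : Real.log t ≤ 2 * baseLevel m δ * k)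
    (hle : threshold m t δ ≤ z₁ / p + z₂ / q) :
    m / δ ≤ √((baseLevel m δ)⁻¹ / (p + (baseLevel m δ)⁻¹)) *
        Real.exp (z₁ / (p + (baseLevel m δ)⁻¹)) *
      (√((baseLevel m δ)⁻¹ / (q + (baseLevel m δ)⁻¹)) *
        Real.exp (z₂ / (q + (baseLevel m δ)⁻¹))) := by
  have hm' : (0 : ℝ) < m := by exact_mod_cast hm
  have ht1 : (1 : ℝ) ≤ t := by exact_mod_cast ht
  have ht0 : (0 : ℝ) < t := by linarith
  have hb := sixteen_le_baseLevel hm hδ hδ1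
  have hbe := baseLevel_eq hm hδ
  rw [threshold_eq hm ht hδ] at hle
  set b := baseLevel m δ
  have hb0 : 0 < b := by linarith
  have hT : 0 ≤ Real.log t := Real.log_nonneg ht1
  have hbud := threshold_budget hb hT hk htk sixteen_le_log_gammaConst
  set β := Real.log t + b + 8 * Real.log (Real.log t + b) with hβ
  have hβ0 : 0 ≤ β := by
    have := two_le_log (x := Real.log t + b) (by linarith)
    linarith
  -- Each square-root prefactor is at least (t b)^(-1/2); the two together cost log (t b) in the
  -- exponent.
  have hroot : ∀ p : ℝ, k ≤ p → p + 1 ≤ t → (t * b)⁻¹ ≤ b⁻¹ / (p + b⁻¹) := by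
    intro p hp hpt
    have hp0 : 0 < p := by linarith
    have : b⁻¹ / (p + b⁻¹) = (p * b + 1)⁻¹ := by field_simp
    rw [this]
    gcongr
    nlinarith
  -- Replacing p by p + 1/b loses a fraction of at most 1 / (b k), since p ≥ k.
  have hfrac : ∀ p z : ℝ, k ≤ p → 0 ≤ z → (1 - 1 / (b * k)) * (z / p) ≤ z / (p + b⁻¹) := by
    intro p z hp hz
    have hp0 : 0 < p := by linarith
    have h1 : z / (p + b⁻¹) = p / (p + b⁻¹) * (z / p) := by field_simp
    rw [h1]
    have h2 : 0 ≤ z / p := by positivity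
    refine mul_le_mul_of_nonneg_right ?_ h2
    have h3 : p / (p + b⁻¹) = 1 - 1 / (b * p + 1) := by field_simp; ring
    rw [h3]
    have : 1 / (b * p + 1) ≤ 1 / (b * k) := by
      gcongr
      nlinarith
    linarith
  have hexp : Real.log (m / δ) + Real.log (t * b) ≤ z₁ / (p + b⁻¹) + z₂ / (q + b⁻¹) := by
    have h1 := hfrac p z₁ hkp hz₁
    have h2 := hfrac q z₂ hkq hz₂
    have hbk : 1 / (b * k) ≤ 1 := by
      rw [div_le_one (by positivity)]
      nlinarith
    have h3 : (1 - 1 / (b * k)) * β ≤ (1 - 1 / (b * k)) * (z₁ / p + z₂ / q) :=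
      mul_le_mul_of_nonneg_left hle (by linarith)
    rw [Real.log_mul ht0.ne' hb0.ne']
    have h4 : (1 - 1 / (b * k)) * β = β - β / (b * k) := by ring
    linarith
  calc (m : ℝ) / δ = √((t * b)⁻¹) * √((t * b)⁻¹) * Real.exp (Real.log (m / δ) + Real.log (t * b)) := by
        rw [Real.mul_self_sqrt (by positivity), Real.exp_add, Real.exp_log (by positivity),
          Real.exp_log (by positivity)]
        field_simp
    _ ≤ √(b⁻¹ / (p + b⁻¹)) * √(b⁻¹ / (q + b⁻¹)) *
          Real.exp (z₁ / (p + b⁻¹) + z₂ / (q + b⁻¹)) := by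
        gcongr
        · exact hroot p hkp hpt
        · exact hroot q hkq hqt
    _ = _ := by
        rw [Real.exp_add]
        ring

end Threshold

end

section

/-! ### Deterministic consequences of exploration and tracking. -/

section Counting

variable {ι : Type*} [DecidableEq ι] {N : ℕ → ι → ℕ} {A : ℕ → ι}

theorem monotone_count (hN : ∀ t i, N (t + 1) i = N t i + if A t = i then 1 else 0) (i : ι) :
    Monotone fun t => N t i :=
  monotone_nat_of_le_succ fun t => by simp [hN t i]

/-- Potential argument: after time n², as long as some count is below n, it is also below √t, so a
least played arm is chosen and the sum of the counts truncated at n grows by one. That sum is at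
most n times the number of arms. -/
theorem le_count_of_explore [Fintype ι]
    (hN : ∀ t i, N (t + 1) i = N t i + if A t = i then 1 else 0)
    (hA : ∀ t : ℕ, (∃ i, (N t i : ℝ) < √(t : ℝ)) → ∀ j, N t (A t) ≤ N t j)
    {n t : ℕ} (ht : n ^ 2 + n * Fintype.card ι ≤ t) (i : ι) : n ≤ N t i := by
  have key : ∀ k : ℕ, (∀ i, n ≤ N (n ^ 2 + k) i) ∨ k ≤ ∑ j, min (N (n ^ 2 + k) j) n := by
    intro k
    induction k with
    | zero => right; exact Nat.zero_le _
    | succ k ih =>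
      by_cases hall : ∀ i, n ≤ N (n ^ 2 + k) i
      · exact Or.inl fun i => (hall i).trans (monotone_count hN i (by omega))
      · have ih' := ih.resolve_left hall
        push Not at hall
        obtain ⟨i, hi⟩ := hall
        right
        have hlt : (N (n ^ 2 + k) i : ℝ) < √((n ^ 2 + k : ℕ) : ℝ) := by
          refine lt_of_lt_of_le (b := (n : ℝ)) (by exact_mod_cast hi) (Real.le_sqrt_of_sq_le ?_)
          push_cast
          linarith [(Nat.cast_nonneg k : (0 : ℝ) ≤ k)]
        have hmin := hA _ ⟨i, hlt⟩ i
        refine Nat.succ_le_of_lt (ih'.trans_lt (Finset.sum_lt_sum (fun j _ => ?_)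
          ⟨A (n ^ 2 + k), Finset.mem_univ _, ?_⟩))
        · exact min_le_min_right _ (monotone_count hN j (by omega))
        · have := hN (n ^ 2 + k) (A (n ^ 2 + k))
          rw [if_pos rfl] at this
          rw [← add_assoc, this]
          omega
  refine le_trans ?_ (monotone_count hN i ht)
  rcases key (n * Fintype.card ι) with h | h
  · exact h i
  · by_contra hcon
    push Not at hcon
    have hlt : ∑ j, min (N (n ^ 2 + n * Fintype.card ι) j) n < ∑ _j : ι, n :=
      Finset.sum_lt_sum (fun j _ => min_le_right _ _)
        ⟨i, Finset.mem_univ _, by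
          rw [min_eq_left hcon.le]
          exact hcon⟩
    simp only [Finset.sum_const, Finset.card_univ, smul_eq_mul] at hlt
    exact absurd h (not_le.2 (hlt.trans_eq (mul_comm _ _)))

/-- A third arm is played only while its count is below √t, so it keeps at most t₀ + √t + 1 plays.
An arm is played only if its count does not exceed those of `a` and `b`, which keeps these two
within t₀ + 1 of each other. They therefore share nearly all of t evenly. -/
theorem le_count_of_track [Fintype ι]
    (hN : ∀ t i, N (t + 1) i = N t i + if A t = i then 1 else 0)
    (hsum : ∀ t, ∑ i, N t i = t) {a b : ι} (hab : a ≠ b) {t₀ : ℕ}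
    (hA : ∀ t : ℕ, t₀ ≤ t → (A t = a ∨ A t = b ∨ (N t (A t) : ℝ) < √(t : ℝ)) ∧
      N t (A t) ≤ N t a ∧ N t (A t) ≤ N t b)
    {t : ℕ} (ht : t₀ ≤ t) :
    (t : ℝ) - (Fintype.card ι + 1) * (t₀ + √(t : ℝ) + 1) ≤ 2 * N t a ∧
      (t : ℝ) - (Fintype.card ι + 1) * (t₀ + √(t : ℝ) + 1) ≤ 2 * N t b := by
  have hother : ∀ j, j ≠ a → j ≠ b → ∀ t, t₀ ≤ t → (N t j : ℝ) ≤ t₀ + √(t : ℝ) + 1 := by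
    intro j hja hjb t ht
    induction t, ht using Nat.le_induction with
    | base =>
      have h1 : N t₀ j ≤ t₀ := by
        conv_rhs => rw [← hsum t₀]
        exact Finset.single_le_sum (f := N t₀) (fun _ _ => Nat.zero_le _) (Finset.mem_univ j)
      have h2 : (N t₀ j : ℝ) ≤ t₀ := by exact_mod_cast h1
      linarith [Real.sqrt_nonneg (t₀ : ℝ)]
    | succ t ht ih =>
      have hs : √(t : ℝ) ≤ √((t + 1 : ℕ) : ℝ) := Real.sqrt_le_sqrt (by push_cast; linarith)
      rw [hN]
      by_cases hj : A t = j
      · have hlt : (N t (A t) : ℝ) < √(t : ℝ) := by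
          rcases (hA t ht).1 with h | h | h
          · exact absurd (hj.symm.trans h) hja
          · exact absurd (hj.symm.trans h) hjb
          · exact h
        rw [if_pos hj]
        rw [hj] at hlt
        push_cast at hs ⊢
        linarith [(Nat.cast_nonneg t₀ : (0 : ℝ) ≤ t₀)]
      · rw [if_neg hj]
        push_cast at hs ⊢
        linarith
  have hbal : ∀ t, t₀ ≤ t → N t a ≤ N t b + (t₀ + 1) ∧ N t b ≤ N t a + (t₀ + 1) := by
    intro t ht
    induction t, ht using Nat.le_induction with
    | base =>
      have h1 : ∀ j, N t₀ j ≤ t₀ := fun j => by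
        conv_rhs => rw [← hsum t₀]
        exact Finset.single_le_sum (f := N t₀) (fun _ _ => Nat.zero_le _) (Finset.mem_univ j)
      have := h1 a
      have := h1 b
      omega
    | succ t ht ih =>
      rw [hN, hN]
      have := (hA t ht).2
      by_cases h1 : A t = a
      · have h2 : A t ≠ b := h1 ▸ hab
        rw [if_pos h1, if_neg h2]
        rw [h1] at this
        omega
      · by_cases h2 : A t = b
        · rw [if_neg h1, if_pos h2]
          rw [h2] at this
          omega
        · rw [if_neg h1, if_neg h2]
          omega
  set w : ℝ := t₀ + √(t : ℝ) + 1 with hw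
  have hw0 : 0 ≤ w := by positivity
  have hs : (N t a : ℝ) + N t b + ∑ j ∈ (Finset.univ.erase a).erase b, (N t j : ℝ) = t := by
    have h1 : (∑ j, (N t j : ℝ)) = t := by exact_mod_cast hsum t
    rw [← h1, ← Finset.add_sum_erase _ _ (Finset.mem_univ a),
      ← Finset.add_sum_erase (Finset.univ.erase a) _
        (Finset.mem_erase.2 ⟨hab.symm, Finset.mem_univ b⟩)]
    ring
  have hs2 : ∑ j ∈ (Finset.univ.erase a).erase b, (N t j : ℝ) ≤ Fintype.card ι * w := by
    calc _ ≤ ∑ _j ∈ (Finset.univ.erase a).erase b, w := by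
          refine Finset.sum_le_sum fun j hj => ?_
          have h1 := Finset.mem_erase.1 hj
          exact hother j (Finset.ne_of_mem_erase h1.2) h1.1 t ht
      _ ≤ ∑ _j : ι, w := Finset.sum_le_sum_of_subset_of_nonneg (Finset.subset_univ _)
          fun _ _ _ => hw0
      _ = _ := by simp
  obtain ⟨hb1, hb2⟩ := hbal t ht
  have hb1' : (N t a : ℝ) ≤ N t b + (t₀ + 1) := by exact_mod_cast hb1
  have hb2' : (N t b : ℝ) ≤ N t a + (t₀ + 1) := by exact_mod_cast hb2
  have := Real.sqrt_nonneg (t : ℝ)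
  constructor <;> nlinarith

end Counting

/-! ### Growth of the threshold and summability of the error probabilities. -/

section Asymptotics

variable {m : ℕ}

theorem log_le_two_sqrt {x : ℝ} (hx : 0 < x) : Real.log x ≤ 2 * √x := by
  have h := Real.log_le_sub_one_of_pos (Real.sqrt_pos.2 hx)
  rw [Real.log_sqrt hx.le] at h
  linarith

/-- A linear function with slope `a` eventually dominates the threshold, uniformly over the
confidence levels with `c log (1 / δ) ≤ t`, if `1 < a c`. -/
theorem exists_threshold_le (hm : 0 < m) {a c : ℝ} (hc : 0 < c) (hac : 1 < a * c) (D E : ℝ) :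
    ∃ t₀ : ℕ, ∀ t : ℕ, t₀ ≤ t → ∀ δ ∈ Set.Ioo (0 : ℝ) 1, c * Real.log (1 / δ) ≤ t →
      threshold m t δ ≤ a * (t - (D * √(t : ℝ) + E)) := by
  have hm' : (1 : ℝ) ≤ m := by exact_mod_cast hm
  have hb1 : 0 < gammaConst * m := mul_pos gammaConst_pos (by linarith)
  set g : ℝ := Real.log (gammaConst * m) with hg
  have hg0 : 0 ≤ g := by
    rw [hg, Real.log_mul gammaConst_pos.ne' (by linarith)]
    linarith [sixteen_le_log_gammaConst, Real.log_nonneg hm']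
  set B : ℝ := 2 + g + 1 / c with hB
  have hB0 : 0 < B := by positivity
  have hac' : 0 < a - 1 / c := by
    rw [sub_pos, div_lt_iff₀ hc]
    exact hac
  -- Here 18 = 2 + 8 · 2: the bound `log t ≤ 2 √t` serves once for the logarithm and eight times for
  -- the iterated logarithm.
  set C : ℝ := |18 + a * D| + |g + 8 * Real.log B + a * E| with hC
  obtain ⟨t₀, ht₀⟩ := exists_nat_ge ((C / (a - 1 / c)) ^ 2)
  refine ⟨max t₀ 1, fun t ht δ hδ hδt => ?_⟩
  have ht1 : (1 : ℝ) ≤ t := by exact_mod_cast (le_max_right _ _).trans ht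
  have htt : (C / (a - 1 / c)) ^ 2 ≤ t :=
    ht₀.trans (by exact_mod_cast (le_max_left _ _).trans ht)
  have hs1 : 1 ≤ √(t : ℝ) := Real.one_le_sqrt.2 ht1
  have hss : √(t : ℝ) * √(t : ℝ) = t := Real.mul_self_sqrt (by linarith)
  have hCs : C ≤ (a - 1 / c) * √(t : ℝ) := by
    have := Real.le_sqrt_of_sq_le htt
    rwa [div_le_iff₀ hac', mul_comm] at this
  have hlog := log_le_two_sqrt (x := (t : ℝ)) (by linarith)
  have hlog' : Real.log t ≤ t := (Real.log_le_sub_one_of_pos (by linarith)).trans (by linarith)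
  have hlog0 : 0 ≤ Real.log t := Real.log_nonneg ht1
  have hL : Real.log (1 / δ) ≤ t / c := by
    rw [le_div_iff₀ hc]
    linarith
  have hbase : baseLevel m δ = g + Real.log (1 / δ) := by
    rw [baseLevel, hg, ← Real.log_mul hb1.ne' (by have := hδ.1; positivity), mul_one_div]
  have hl16 := sixteen_le_baseLevel hm hδ.1 hδ.2
  have hbB : Real.log t + baseLevel m δ ≤ B * t := by
    rw [hbase, hB]
    have : g ≤ g * t := le_mul_of_one_le_right hg0 ht1
    have : t / c = 1 / c * t := by ring
    nlinarith
  have hloglog : Real.log (Real.log t + baseLevel m δ) ≤ Real.log B + Real.log t := by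
    rw [← Real.log_mul hB0.ne' (by linarith)]
    exact Real.log_le_log (by linarith) hbB
  rw [threshold_eq hm (by exact_mod_cast ht1) hδ.1]
  have h1 : 18 + a * D ≤ |18 + a * D| := le_abs_self _
  have h2 : g + 8 * Real.log B + a * E ≤ |g + 8 * Real.log B + a * E| := le_abs_self _
  have h3 : (18 + a * D) * √(t : ℝ) + (g + 8 * Real.log B + a * E) ≤ C * √(t : ℝ) := by
    have h4 : |g + 8 * Real.log B + a * E| ≤ |g + 8 * Real.log B + a * E| * √(t : ℝ) :=
      le_mul_of_one_le_right (abs_nonneg _) hs1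
    rw [hC]
    nlinarith
  have h5 : C * √(t : ℝ) ≤ (a - 1 / c) * t := by
    calc C * √(t : ℝ) ≤ (a - 1 / c) * √(t : ℝ) * √(t : ℝ) := by gcongr
      _ = _ := by rw [mul_assoc, hss]
  have h6 : t / c = 1 / c * t := by ring
  have h7 : Real.log t + baseLevel m δ ≤ 2 * √(t : ℝ) + g + 1 / c * t := by
    rw [hbase]
    linarith
  linarith

/-- An index of order `t ^ (1 / 4)`. -/
def fourthRoot (t : ℕ) : ℕ := Nat.sqrt (Nat.sqrt t)

theorem one_le_fourthRoot {t : ℕ} (ht : 1 ≤ t) : 1 ≤ fourthRoot t := by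
  unfold fourthRoot
  rw [Nat.le_sqrt, Nat.le_sqrt]
  simpa using ht

theorem fourthRoot_sq_le (t : ℕ) : ((fourthRoot t : ℕ) : ℝ) ^ 2 ≤ √(t : ℝ) := by
  have h : fourthRoot t ^ 2 ≤ Nat.sqrt t := Nat.sqrt_le' _
  calc ((fourthRoot t : ℕ) : ℝ) ^ 2 ≤ (Nat.sqrt t : ℝ) := by exact_mod_cast h
    _ ≤ √(t : ℝ) := Real.nat_sqrt_le_real_sqrt

theorem lt_fourthRoot_succ_pow (t : ℕ) : t < (fourthRoot t + 1) ^ 4 := by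
  have h1 := Nat.lt_succ_sqrt' t
  have h2 := Nat.lt_succ_sqrt' (Nat.sqrt t)
  have h3 : Nat.sqrt t + 1 ≤ (fourthRoot t + 1) ^ 2 := h2
  calc t < (Nat.sqrt t + 1) ^ 2 := h1
    _ ≤ ((fourthRoot t + 1) ^ 2) ^ 2 := Nat.pow_le_pow_left h3 2
    _ = _ := by ring

/-- Comparison with 1 / (t + 1)²: the exponential beats the eighth power of `fourthRoot t + 1`,
which is at least (t + 1)². -/
theorem summable_exp_fourthRoot {k : ℝ} (hk : 0 < k) :
    Summable fun t : ℕ => Real.exp (-(k * fourthRoot t)) := by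
  have hbdd : ∃ C : ℝ, ∀ n : ℕ, Real.exp (-(k * n)) * ((n : ℝ) + 1) ^ 8 ≤ C := by
    refine ⟨Real.exp k * (Nat.factorial 8 : ℕ) / k ^ 8, fun n => ?_⟩
    have h := Real.pow_div_factorial_le_exp (k * (n + 1)) (by positivity) 8
    rw [div_le_iff₀ (by positivity), mul_pow] at h
    rw [le_div_iff₀ (by positivity)]
    calc Real.exp (-(k * n)) * ((n : ℝ) + 1) ^ 8 * k ^ 8
        = Real.exp (-(k * n)) * (k ^ 8 * ((n : ℝ) + 1) ^ 8) := by ring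
      _ ≤ Real.exp (-(k * n)) * (Real.exp (k * (n + 1)) * (Nat.factorial 8 : ℕ)) := by gcongr
      _ = Real.exp (-(k * n) + k * (n + 1)) * (Nat.factorial 8 : ℕ) := by rw [Real.exp_add]; ring
      _ = _ := by ring_nf
  obtain ⟨C, hC⟩ := hbdd
  have hC0 : 0 ≤ C := (by positivity : (0 : ℝ) ≤ _).trans (hC 0)
  have hsum : Summable fun t : ℕ => C * (1 / ((t + 1 : ℕ) : ℝ) ^ 2) :=
    ((summable_nat_add_iff 1).2 (Real.summable_one_div_nat_pow.2 one_lt_two)).mul_left C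
  refine hsum.of_nonneg_of_le (fun t => (Real.exp_pos _).le) fun t => ?_
  have h1 := hC (fourthRoot t)
  have h2 : ((t + 1 : ℕ) : ℝ) ≤ ((fourthRoot t : ℝ) + 1) ^ 4 := by
    exact_mod_cast Nat.succ_le_of_lt (lt_fourthRoot_succ_pow t)
  have h3 : ((t + 1 : ℕ) : ℝ) ^ 2 ≤ ((fourthRoot t : ℝ) + 1) ^ 8 := by
    calc ((t + 1 : ℕ) : ℝ) ^ 2 ≤ (((fourthRoot t : ℝ) + 1) ^ 4) ^ 2 := by gcongr
      _ = _ := by ring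
  rw [mul_one_div, le_div_iff₀ (by positivity)]
  exact (mul_le_mul_of_nonneg_left h3 (Real.exp_pos _).le).trans h1

end Asymptotics

end

/-! ### Environments, stopping times and numbers of plays under CPI. -/

section

variable {m : ℕ} {σ : ℝ≥0} {δ : ℝ} {π : Policy m}

namespace Env

variable (v : Env m)

theorem mean_eq {i : Fin m} (hi : i ≠ v.cp) : v.mean i.castSucc = v.mean i.succ := by
  by_contra h
  have : i ∈ changePoints v.mean := h
  rw [v.changePoints_eq] at this
  exact hi this

theorem jump_pos : 0 < v.jump := by
  have : v.cp ∈ changePoints v.mean := by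
    rw [v.changePoints_eq]
    exact Set.mem_singleton _
  exact abs_pos.2 (sub_ne_zero.2 this)

theorem pos (v : Env m) : 0 < m := v.cp.pos

end Env

section Time

variable (v : Env m) (ω : Sample)

theorem Policy.stopTime_le {t : ℕ} (h : π.StopsAt v ω t) : π.stopTime v ω ≤ t :=
  iInf₂_le t h

theorem Policy.stopsAt_of_stopTime_eq {t : ℕ} (h : π.stopTime v ω = t) : π.StopsAt v ω t := by
  by_contra hcon
  have hge : ((t + 1 : ℕ) : ℕ∞) ≤ π.stopTime v ω := by
    refine le_iInf₂ fun s hs => ?_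
    have hst : ¬ s < t := fun hlt => by
      have := Policy.stopTime_le v ω hs
      rw [h] at this
      exact absurd (by exact_mod_cast this : t ≤ s) (not_le.2 hlt)
    have hne : s ≠ t := fun he => hcon (he ▸ hs)
    exact_mod_cast (by omega : t + 1 ≤ s)
  rw [h] at hge
  have : t + 1 ≤ t := by exact_mod_cast hge
  omega

end Time

section Pulls

variable (μ : Fin (m + 1) → ℝ) (ω : Sample)

theorem pulls_history_succ (t : ℕ) (i : Fin (m + 1)) :
    pulls (π.history μ ω (t + 1)) i = pulls (π.history μ ω t) i +
      if π.act t ω.1 (π.history μ ω t) = i then 1 else 0 := by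
  rw [Policy.history, pulls_snoc]

theorem IsCPI.least_of_lt_sqrt (hπ : IsCPI σ δ π) (t : ℕ) (u : unitInterval) (h : Hist m t)
    (hlt : ∃ i, (pulls h i : ℝ) < √(t : ℝ)) (j : Fin (m + 1)) :
    pulls h (π.act t u h) ≤ pulls h j := by
  rcases lt_or_ge t (m + 1) with ht | ht
  · rw [hπ.init t u h ht]
    exact Nat.zero_le _
  · exact hπ.explore t u h ht hlt j

/-- Forced exploration. -/
theorem IsCPI.le_pulls (hπ : IsCPI σ δ π) {n t : ℕ} (ht : n ^ 2 + n * (m + 1) ≤ t)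
    (i : Fin (m + 1)) : n ≤ pulls (π.history μ ω t) i :=
  le_count_of_explore (N := fun t => pulls (π.history μ ω t))
    (A := fun t => π.act t ω.1 (π.history μ ω t)) (fun t i => pulls_history_succ μ ω t i)
    (fun t ht j => hπ.least_of_lt_sqrt t ω.1 _ ht j) (by simpa using ht) i

theorem pulls_add_pulls_le {t : ℕ} (h : Hist m t) {a b : Fin (m + 1)} (hab : a ≠ b) :
    pulls h a + pulls h b ≤ t := by
  rw [← Finset.sum_pair (f := fun i => pulls h i) hab]
  exact (Finset.sum_le_sum_of_subset (Finset.subset_univ _)).trans (sum_pulls h).le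

/-- Either the time or the number of plays of every arm is controlled by the base level. -/
theorem IsCPI.exists_le_pulls (hπ : IsCPI σ δ π) (hm : 0 < m) (hδ : 0 < δ) (hδ1 : δ < 1) {t : ℕ}
    (ht : 0 < t) :
    Real.log t ≤ 2 * baseLevel m δ ∨ ∃ n : ℕ, 1 ≤ n ∧
      Real.log t ≤ 2 * baseLevel m δ * n ∧ ∀ i, n ≤ pulls (π.history μ ω t) i := by
  rcases le_or_gt (Real.log t) (2 * baseLevel m δ) with hlt | hlt
  · exact Or.inl hlt
  right
  have ht0 : (0 : ℝ) < t := by exact_mod_cast ht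
  have hm1 : (1 : ℝ) ≤ m := by exact_mod_cast hm
  have hb := sixteen_le_baseLevel hm hδ hδ1
  have hsq : 4 * ((m : ℝ) + 1) ≤ √(t : ℝ) := by
    have h1 : baseLevel m δ < Real.log √(t : ℝ) := by
      rw [Real.log_sqrt ht0.le]
      linarith
    have h2 := Real.exp_lt_exp.2 h1
    rw [Real.exp_log (Real.sqrt_pos.2 ht0), baseLevel,
      Real.exp_log (by have := gammaConst_pos; positivity)] at h2
    have h3 : 17 ≤ gammaConst := by
      have h4 := Real.exp_le_exp.2 sixteen_le_log_gammaConst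
      rw [Real.exp_log gammaConst_pos] at h4
      linarith [Real.add_one_le_exp (16 : ℝ)]
    have h5 : gammaConst * m ≤ gammaConst * m / δ := by
      rw [le_div_iff₀ hδ]
      have : 0 ≤ gammaConst * m := by have := gammaConst_pos; positivity
      nlinarith
    nlinarith
  set r := Nat.sqrt t with hr
  have hr1 : √(t : ℝ) ≤ r + 1 := Real.real_sqrt_le_nat_sqrt_succ
  have hr2 : r ^ 2 ≤ t := Nat.sqrt_le' t
  have hr3 : 2 * (m + 1) ≤ r := by
    have : (2 * (m + 1) : ℝ) ≤ r := by linarith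
    exact_mod_cast this
  have hn1 : 2 * (r / 2) ≤ r := Nat.mul_div_le r 2
  have hn2 : r ≤ 2 * (r / 2) + 1 := by omega
  have hn2' : (r : ℝ) ≤ 2 * (r / 2 : ℕ) + 1 := by exact_mod_cast hn2
  -- With n about √t / 2 and r ≥ 2 (m + 1), the exploration time n² + n (m + 1) is at most r² ≤ t.
  refine ⟨r / 2, by omega, ?_, hπ.le_pulls μ ω ?_⟩
  · have hlog := log_le_two_sqrt ht0
    have h4 : √(t : ℝ) ≤ 4 * (r / 2 : ℕ) := by linarith
    have h5 : (0 : ℝ) ≤ (r / 2 : ℕ) := Nat.cast_nonneg _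
    nlinarith
  · generalize r / 2 = n at hn1
    nlinarith

end Pulls

/-! ### Probability of a wrong recommendation. -/

section Correctness

/-- The stopping statistic at a position without a change is dominated by the noise of both arms. -/
theorem stat_le {t : ℕ} {μ : Fin (m + 1) → ℝ} {h : Hist m t} {i : Fin m}
    (hi : μ i.castSucc = μ i.succ) (hp : pulls h i.castSucc ≠ 0) (hq : pulls h i.succ ≠ 0)
    (hσ : 0 < σ) :
    stat σ h i ≤ (noiseSum μ h i.castSucc ^ 2 / (2 * (σ : ℝ) ^ 2)) / pulls h i.castSucc +
      (noiseSum μ h i.succ ^ 2 / (2 * (σ : ℝ) ^ 2)) / pulls h i.succ := by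
  have hσ' : (0 : ℝ) < σ := hσ
  rw [stat, empJump, sq_abs, empMean_eq μ h _ hp, empMean_eq μ h _ hq, hi]
  have hp' : (0 : ℝ) < pulls h i.castSucc := by exact_mod_cast Nat.pos_of_ne_zero hp
  have hq' : (0 : ℝ) < pulls h i.succ := by exact_mod_cast Nat.pos_of_ne_zero hq
  generalize (pulls h i.castSucc : ℝ) = p at hp'
  generalize (pulls h i.succ : ℝ) = q at hq'
  generalize noiseSum μ h i.castSucc = x
  generalize noiseSum μ h i.succ = y
  -- The common mean cancels, and the defect is the square belonging to the pooled noise of the two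
  -- arms.
  have : x ^ 2 / (2 * (σ : ℝ) ^ 2) / p + y ^ 2 / (2 * (σ : ℝ) ^ 2) / q -
      p * q / (2 * (σ : ℝ) ^ 2 * (p + q)) * (μ i.succ + x / p - (μ i.succ + y / q)) ^ 2 =
      (x + y) ^ 2 / (2 * (σ : ℝ) ^ 2 * (p + q)) := by
    field_simp
    ring
  have h2 : 0 ≤ (x + y) ^ 2 / (2 * (σ : ℝ) ^ 2 * (p + q)) := by positivity
  linarith

/-- The mixture martingale of the noise of the two arms adjacent to position `i`. -/
noncomputable def pairMix (σ : ℝ≥0) (c : ℝ) (μ : Fin (m + 1) → ℝ) (i : Fin m) (t : ℕ)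
    (h : Hist m t) : ℝ≥0∞ :=
  ∏ j ∈ {i.castSucc, i.succ}, mixWeight σ c (pulls h j) (noiseSum μ h j)

theorem law_pairMix_ge_le (π : Policy m) (hσ : 0 < σ) {c : ℝ} (hc : 0 < c)
    (μ : Fin (m + 1) → ℝ) (i : Fin m) (a : ℝ≥0∞) :
    law σ {ω | ∃ t, a ≤ pairMix σ c μ i t (π.history μ ω t)} ≤ a⁻¹ := by
  refine (IsSupermart.prod_finset (measurable_mixWeight c)
    (fun n s => (lintegral_mixWeight hσ hc n s).le) _).ville (fun h => ?_) π a
  refine Finset.prod_le_one' fun j _ => ?_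
  simp [mixWeight, hc.ne']

theorem threshold_pos (hm : 0 < m) {t : ℕ} (ht : 0 < t) (hδ : 0 < δ) (hδ1 : δ < 1) :
    0 < threshold m t δ := by
  have hb := sixteen_le_baseLevel hm hδ hδ1
  have ht1 : (1 : ℝ) ≤ t := by exact_mod_cast ht
  have hl := Real.log_nonneg ht1
  rw [threshold_eq hm ht hδ]
  have := two_le_log (x := Real.log t + baseLevel m δ) (by linarith)
  linarith

theorem IsCPI.le_pairMix_of_wrong (hπ : IsCPI σ δ π) (hσ : 0 < σ) (hδ : 0 < δ) (hδ1 : δ < 1)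
    (v : Env m) (ω : Sample) {t : ℕ} (halted : π.StopsAt v ω t)
    (hne : π.recommend t ω.1 (π.history v.mean ω t) ≠ v.cp) :
    ENNReal.ofReal (m / δ) ≤ pairMix σ (baseLevel m δ)⁻¹ v.mean
      (π.recommend t ω.1 (π.history v.mean ω t)) t (π.history v.mean ω t) := by
  have hσ' : (0 : ℝ) < σ := hσ
  have hm := v.pos
  obtain ⟨hmt, hle⟩ := (hπ.halt_iff t ω.1 _).1 halted
  have ht : 0 < t := by omega
  set h := π.history v.mean ω t with hh
  set i := π.recommend t ω.1 h
  have hthr := threshold_pos hm ht hδ hδ1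
  -- An unplayed arm would make the statistic zero, below the positive threshold.
  have hp : pulls h i.castSucc ≠ 0 := fun h0 => by
    rw [stat, h0] at hle
    simp only [CharP.cast_eq_zero, zero_mul, zero_div] at hle
    linarith
  have hq : pulls h i.succ ≠ 0 := fun h0 => by
    rw [stat, h0] at hle
    simp only [CharP.cast_eq_zero, mul_zero, zero_mul, zero_div] at hle
    linarith
  have hneq : i.castSucc ≠ i.succ := (Fin.castSucc_lt_succ).ne
  have hpq := pulls_add_pulls_le h hneq
  have hle2 := hle.trans (stat_le (v.mean_eq hne) hp hq hσ)
  have key : ∀ k : ℝ, 1 ≤ k → k ≤ pulls h i.castSucc → k ≤ pulls h i.succ →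
      Real.log t ≤ 2 * baseLevel m δ * k →
      ENNReal.ofReal (m / δ) ≤ pairMix σ (baseLevel m δ)⁻¹ v.mean i t h := by
    intro k hk hkp hkq hlog
    have := le_mix_of_threshold_le hm hδ hδ1 ht hk hkp hkq
      (by exact_mod_cast (by omega : pulls h i.castSucc + 1 ≤ t))
      (by exact_mod_cast (by omega : pulls h i.succ + 1 ≤ t)) (by positivity) (by positivity)
      hlog hle2
    rw [pairMix, Finset.prod_pair hneq, mixWeight, mixWeight,
      ← ENNReal.ofReal_mul (by positivity)]
    refine ENNReal.ofReal_le_ofReal (this.trans_eq ?_)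
    simp only [div_div]
  -- For small t a single play of each arm gives k = 1; for large t the term log t in the loss is
  -- absorbed by the plays that exploration forces.
  rcases hπ.exists_le_pulls v.mean ω hm hδ hδ1 ht with hlog | ⟨n, hn, hlog, hall⟩
  · exact key 1 le_rfl (by exact_mod_cast Nat.one_le_iff_ne_zero.2 hp)
      (by exact_mod_cast Nat.one_le_iff_ne_zero.2 hq) (by linarith)
  · exact key n (by exact_mod_cast hn) (by exact_mod_cast hall i.castSucc)
      (by exact_mod_cast hall i.succ) hlog

/-- Only m - 1 positions can be wrong and each costs δ / m, which leaves the margin δ / m that makes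
the inequality strict. -/
theorem IsCPI.lt_law_correct (hπ : IsCPI σ δ π) (hσ : 0 < σ) (hδ : 0 < δ) (hδ1 : δ < 1)
    (v : Env m) (halted : law σ {ω | π.stopTime v ω < ⊤} = 1) :
    ENNReal.ofReal (1 - δ) < law σ {ω | ∃ t : ℕ, π.stopTime v ω = t ∧
      π.recommend t ω.1 (π.history v.mean ω t) = v.cp} := by
  set C := {ω | ∃ t : ℕ, π.stopTime v ω = t ∧
      π.recommend t ω.1 (π.history v.mean ω t) = v.cp}
  have hm := v.pos
  have hm' : (0 : ℝ) < m := by exact_mod_cast hm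
  have hb : 0 < (baseLevel m δ)⁻¹ := by
    have := sixteen_le_baseLevel hm hδ hδ1
    positivity
  let W : Fin m → Set Sample := fun i => {ω | ∃ t,
    ENNReal.ofReal (m / δ) ≤ pairMix σ (baseLevel m δ)⁻¹ v.mean i t (π.history v.mean ω t)}
  have hW : ∀ i, law σ (W i) ≤ ENNReal.ofReal (δ / m) := fun i => by
    refine (law_pairMix_ge_le π hσ hb v.mean i _).trans_eq ?_
    rw [← ENNReal.ofReal_inv_of_pos (by positivity), inv_div]
  have hE : law σ (⋃ i ∈ Finset.univ.erase v.cp, W i) ≤ ENNReal.ofReal ((m - 1) * (δ / m)) := by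
    calc _ ≤ ∑ i ∈ Finset.univ.erase v.cp, law σ (W i) := measure_biUnion_finset_le _ _
      _ ≤ ∑ _i ∈ Finset.univ.erase v.cp, ENNReal.ofReal (δ / m) :=
          Finset.sum_le_sum fun i _ => hW i
      _ = _ := by
          rw [Finset.sum_const, Finset.card_erase_of_mem (Finset.mem_univ _), Finset.card_univ,
            Fintype.card_fin, nsmul_eq_mul, ← ENNReal.ofReal_natCast,
            ← ENNReal.ofReal_mul (Nat.cast_nonneg _), Nat.cast_sub hm, Nat.cast_one]
  have hcover : {ω | π.stopTime v ω < ⊤} ⊆ C ∪ ⋃ i ∈ Finset.univ.erase v.cp, W i := by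
    intro ω hω
    obtain ⟨t, ht⟩ := ENat.ne_top_iff_exists.1 (ne_of_lt (show π.stopTime v ω < ⊤ from hω))
    by_cases hc : π.recommend t ω.1 (π.history v.mean ω t) = v.cp
    · exact Or.inl ⟨t, ht.symm, hc⟩
    · refine Or.inr (Set.mem_biUnion (Finset.mem_coe.2 (Finset.mem_erase.2
        ⟨hc, Finset.mem_univ _⟩)) ⟨t, ?_⟩)
      exact hπ.le_pairMix_of_wrong hσ hδ hδ1 v ω
        (Policy.stopsAt_of_stopTime_eq v ω ht.symm) hc
  have h1 : 1 ≤ law σ C + ENNReal.ofReal ((m - 1) * (δ / m)) := by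
    rw [← halted]
    exact (measure_mono hcover).trans ((measure_union_le _ _).trans (by gcongr))
  by_contra hcon
  push Not at hcon
  have hlt : (1 - δ) + (m - 1) * (δ / m) < 1 := by
    have : (m - 1) * (δ / m) = δ - δ / m := by field_simp
    have : 0 < δ / m := by positivity
    linarith
  have hm1 : (1 : ℝ) ≤ m := by exact_mod_cast hm
  have h2 := h1.trans (add_le_add_left hcon _)
  rw [← ENNReal.ofReal_add (by linarith) (mul_nonneg (by linarith) (by positivity))] at h2
  rw [ENNReal.one_le_ofReal] at h2
  linarith

end Correctness

end

/-! ### Upper bound for the stopping time. -/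

section

variable {m : ℕ} {σ : ℝ≥0} {δ : ℝ} {π : Policy m}

theorem abs_empMean_sub_lt {t : ℕ} {h : Hist m t} {μ : Fin (m + 1) → ℝ} {ε : ℝ}
    {i : Fin (m + 1)} (hp : 1 ≤ pulls h i) (hS : |noiseSum μ h i| < ε * pulls h i) :
    |empMean h i - μ i| < ε := by
  have hp' : (0 : ℝ) < pulls h i := by exact_mod_cast hp
  rw [empMean_eq μ h i (by omega), add_sub_cancel_left, abs_div, abs_of_pos hp', div_lt_iff₀ hp']
  exact hS

theorem lt_empJump_cp {t : ℕ} {h : Hist m t} (v : Env m) {ε : ℝ}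
    (hdev : ∀ i, |empMean h i - v.mean i| < ε) : v.jump - 2 * ε < empJump h v.cp := by
  have h1 := abs_lt.1 (hdev v.cp.castSucc)
  have h2 := abs_lt.1 (hdev v.cp.succ)
  have h3 := le_abs_self (empMean h v.cp.castSucc - empMean h v.cp.succ)
  have h4 := neg_le_abs (empMean h v.cp.castSucc - empMean h v.cp.succ)
  rw [empJump, Env.jump]
  rcases abs_cases (v.mean v.cp.castSucc - v.mean v.cp.succ) with ⟨h, -⟩ | ⟨h, -⟩ <;> rw [h] <;>
    linarith

theorem empJump_lt_of_ne {t : ℕ} {h : Hist m t} (v : Env m) {ε : ℝ}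
    (hdev : ∀ i, |empMean h i - v.mean i| < ε) {i : Fin m} (hi : i ≠ v.cp) :
    empJump h i < 2 * ε := by
  have h1 := abs_lt.1 (hdev i.castSucc)
  have h2 := abs_lt.1 (hdev i.succ)
  have h3 := v.mean_eq hi
  rw [empJump, abs_lt]
  constructor <;> linarith

/-- The empirical jump exceeds Δ - 2ε ≥ 2ε at the change and is below 2ε elsewhere. -/
theorem IsCPI.recommend_eq (hπ : IsCPI σ δ π) (v : Env m) {t : ℕ} (ht : m + 1 ≤ t)
    (u : unitInterval) {h : Hist m t} {ε : ℝ} (hε : 4 * ε ≤ v.jump)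
    (hdev : ∀ i, |empMean h i - v.mean i| < ε) : π.recommend t u h = v.cp := by
  by_contra hne
  have h1 := hπ.argmax t u h ht v.cp
  have h2 := lt_empJump_cp v hdev
  have h3 := empJump_lt_of_ne v hdev hne
  linarith

/-- Because the deviation event covers all times, its complement keeps the estimate correct
throughout the interval from t₀ to t. Tracking thus gives both relevant arms at least half of t -
O(√t) plays, and the statistic is above the threshold. -/
theorem IsCPI.stopsAt_of_notMem_deviationEvent (hπ : IsCPI σ δ π) (hσ : 0 < σ) (hδ : 0 < δ)
    (hδ1 : δ < 1) (v : Env m) {ε : ℝ} (hε : 0 < ε) (hεv : 4 * ε ≤ v.jump) {t : ℕ} (ht : 1 ≤ t)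
    {ω : Sample} (hω : ω ∉ deviationEvent π v.mean ε (fourthRoot t))
    (hthr : threshold m t δ ≤ (v.jump - 2 * ε) ^ 2 / (8 * (σ : ℝ) ^ 2) *
      (t - ((m + 2) * (m + 3) * √(t : ℝ) + (m + 2)))) :
    π.StopsAt v ω t := by
  have hσ' : (0 : ℝ) < σ := hσ
  have hm := v.pos
  set n := fourthRoot t with hn
  -- The time after which exploration guarantees n plays of every arm; with n of order t^(1/4) it is
  -- only O(√t).
  set t₀ := n ^ 2 + n * (m + 1) with ht₀
  have hn1 : 1 ≤ n := one_le_fourthRoot ht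
  have hmt₀ : m + 1 ≤ t₀ := by nlinarith
  have ht₀s : (t₀ : ℝ) ≤ (m + 2) * √(t : ℝ) := by
    have h1 := fourthRoot_sq_le t
    have h2 : (n : ℝ) ≤ n ^ 2 := by exact_mod_cast (by nlinarith : n ≤ n ^ 2)
    rw [ht₀]
    push_cast
    have h3 : (n : ℝ) * (m + 1) ≤ √(t : ℝ) * (m + 1) := by
      gcongr
      exact h2.trans h1
    linarith
  have hx : 0 < (t : ℝ) - ((m + 2) * (m + 3) * √(t : ℝ) + (m + 2)) := by
    have := (threshold_pos hm ht hδ hδ1).trans_le hthr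
    exact (pos_iff_pos_of_mul_pos this).1 (lt_of_le_of_ne (by positivity) fun h0 => by
      rw [← h0, zero_mul] at this
      exact lt_irrefl _ this)
  have hsqrt0 := Real.sqrt_nonneg (t : ℝ)
  have htt₀ : t₀ ≤ t := by
    have : (t₀ : ℝ) ≤ t := by nlinarith
    exact_mod_cast this
  have hpull : ∀ s, t₀ ≤ s → ∀ i, n ≤ pulls (π.history v.mean ω s) i := fun s hs i =>
    hπ.le_pulls v.mean ω hs i
  have hdev : ∀ s, t₀ ≤ s → ∀ i, |empMean (π.history v.mean ω s) i - v.mean i| < ε := by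
    intro s hs i
    refine abs_empMean_sub_lt (hn1.trans (hpull s hs i)) ?_
    by_contra hcon
    exact hω ⟨s, i, hpull s hs i, not_lt.1 hcon⟩
  have hrec : ∀ s, t₀ ≤ s → π.recommend s ω.1 (π.history v.mean ω s) = v.cp := fun s hs =>
    hπ.recommend_eq v (hmt₀.trans hs) ω.1 hεv (hdev s hs)
  have hneq : v.cp.castSucc ≠ v.cp.succ := (Fin.castSucc_lt_succ).ne
  have htrack := le_count_of_track (N := fun t => pulls (π.history v.mean ω t))
    (A := fun t => π.act t ω.1 (π.history v.mean ω t))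
    (fun t i => pulls_history_succ v.mean ω t i) (fun t => sum_pulls _) hneq (t₀ := t₀)
    (fun s hs => by
      by_cases hlt : ∃ i, (pulls (π.history v.mean ω s) i : ℝ) < √(s : ℝ)
      · have hex := hπ.explore s ω.1 _ (hmt₀.trans hs) hlt
        obtain ⟨i, hi⟩ := hlt
        refine ⟨Or.inr (Or.inr (lt_of_le_of_lt ?_ hi)), hex _, hex _⟩
        exact_mod_cast hex i
      · push Not at hlt
        obtain ⟨h1, h2, h3⟩ := hπ.track s ω.1 _ (hmt₀.trans hs) hlt
        rw [hrec s hs] at h1 h2 h3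
        exact ⟨h1.elim Or.inl fun h => Or.inr (Or.inl h), h2, h3⟩) htt₀
  refine (hπ.halt_iff t ω.1 _).2 ⟨hmt₀.trans htt₀, hthr.trans ?_⟩
  rw [hrec t htt₀, stat]
  have hp0 : 1 ≤ pulls (π.history v.mean ω t) v.cp.castSucc := hn1.trans (hpull t htt₀ _)
  have hq0 : 1 ≤ pulls (π.history v.mean ω t) v.cp.succ := hn1.trans (hpull t htt₀ _)
  have hp0' : (1 : ℝ) ≤ pulls (π.history v.mean ω t) v.cp.castSucc := by exact_mod_cast hp0
  have hq0' : (1 : ℝ) ≤ pulls (π.history v.mean ω t) v.cp.succ := by exact_mod_cast hq0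
  have hJ := lt_empJump_cp v (hdev t htt₀)
  simp only [Fintype.card_fin] at htrack
  set p : ℝ := ((pulls (π.history v.mean ω t) v.cp.castSucc : ℕ) : ℝ)
  set q : ℝ := ((pulls (π.history v.mean ω t) v.cp.succ : ℕ) : ℝ)
  set J := empJump (π.history v.mean ω t) v.cp
  set x : ℝ := (t : ℝ) - ((m + 2) * (m + 3) * √(t : ℝ) + (m + 2)) with hxdef
  have hxw : x ≤ (t : ℝ) - (((m + 1 : ℕ) : ℝ) + 1) * (t₀ + √(t : ℝ) + 1) := by
    rw [hxdef]
    push_cast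
    have hm0 : (0 : ℝ) ≤ m := Nat.cast_nonneg m
    have : ((m : ℝ) + 2) * t₀ ≤ (m + 2) * ((m + 2) * √(t : ℝ)) := by gcongr
    linarith
  have hxp : x ≤ 2 * p := hxw.trans htrack.1
  have hxq : x ≤ 2 * q := hxw.trans htrack.2
  have hpq : x / 4 ≤ p * q / (p + q) := by
    rw [le_div_iff₀ (by linarith)]
    nlinarith
  have hJ2 : (v.jump - 2 * ε) ^ 2 ≤ J ^ 2 := by
    have : 0 ≤ v.jump - 2 * ε := by linarith
    gcongr
  calc (v.jump - 2 * ε) ^ 2 / (8 * (σ : ℝ) ^ 2) * x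
      = x / 4 / (2 * (σ : ℝ) ^ 2) * (v.jump - 2 * ε) ^ 2 := by ring
    _ ≤ p * q / (p + q) / (2 * (σ : ℝ) ^ 2) * J ^ 2 := by gcongr
    _ = _ := by
        congr 1
        rw [div_div, mul_comm (p + q)]

/-- Every time from T on that passes before stopping is a time whose bad event occurs, so the delay
beyond T is at most the number of bad events. -/
theorem stopTime_le_of_eventually (v : Env m) (ω : Sample) (B : ℕ → Set Sample) (T : ℕ)
    (h : ∀ t, T ≤ t → ω ∉ B t → π.StopsAt v ω t) :
    (π.stopTime v ω : ℝ≥0∞) ≤ T + ∑' t, (B t).indicator 1 ω := by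
  have key : ∀ k : ℕ, (k : ℕ∞) ≤ π.stopTime v ω →
      (k : ℝ≥0∞) ≤ T + ∑' t, (B t).indicator 1 ω := by
    intro k hk
    have hmem : ∀ t ∈ Finset.Ico T k, (B t).indicator (1 : Sample → ℝ≥0∞) ω = 1 := by
      intro t ht
      rw [Finset.mem_Ico] at ht
      refine Set.indicator_of_mem ?_ _
      by_contra hcon
      have h1 := hk.trans (Policy.stopTime_le v ω (h t ht.1 hcon))
      exact absurd (by exact_mod_cast h1 : k ≤ t) (not_le.2 ht.2)
    calc (k : ℝ≥0∞) ≤ T + ((k - T : ℕ) : ℝ≥0∞) := by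
          exact_mod_cast (by omega : k ≤ T + (k - T))
      _ = T + ∑ t ∈ Finset.Ico T k, (B t).indicator (1 : Sample → ℝ≥0∞) ω := by
          rw [Finset.sum_congr rfl hmem]
          simp
      _ ≤ _ := by
          gcongr
          exact ENNReal.sum_le_tsum _
  cases hτ : π.stopTime v ω with
  | top =>
    rw [hτ] at key
    refine le_of_eq (ENNReal.eq_top_of_forall_nnreal_le fun r => ?_).symm
    obtain ⟨k, hk⟩ := exists_nat_ge r
    exact le_trans (by exact_mod_cast hk) (key k le_top)
  | coe k => exact key k hτ.ge

theorem tsum_law_deviationEvent_lt_top {ε : ℝ} (hσ : 0 < σ) (hε : 0 < ε) :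
    ∑' t : ℕ, (2 * (m + 1) : ℕ) *
      ENNReal.ofReal (Real.exp (-(ε ^ 2 / (2 * (σ : ℝ) ^ 2) * fourthRoot t))) < ⊤ := by
  have hσ' : (0 : ℝ) < σ := hσ
  rw [ENNReal.tsum_mul_left, ← ENNReal.ofReal_tsum_of_nonneg (fun _ => (Real.exp_pos _).le)
    (summable_exp_fourthRoot (by positivity))]
  exact ENNReal.mul_lt_top (ENNReal.natCast_lt_top _) ENNReal.ofReal_lt_top

/-- Nonasymptotic bound: for every `c > 8 σ² / Δ²`, the stopping time of CPI is dominated, up to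
an additive term whose expectation is bounded uniformly in `δ`, by `c log (1 / δ)`. -/
theorem exists_stopTime_le (hσ : 0 < σ) (v : Env m) {c : ℝ}
    (hc : 8 * (σ : ℝ) ^ 2 / v.jump ^ 2 < c) :
    ∃ C : ℝ≥0∞, C ≠ ⊤ ∧ ∀ δ ∈ Set.Ioo (0 : ℝ) 1, ∀ π : Policy m, IsCPI σ δ π →
      ∃ G : Sample → ℝ≥0∞, Measurable G ∧ (∀ ω, (π.stopTime v ω : ℝ≥0∞) ≤ G ω) ∧
        ∫⁻ ω, G ω ∂law σ ≤ ENNReal.ofReal (c * Real.log (1 / δ)) + C := by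
  have hσ' : (0 : ℝ) < σ := hσ
  have hJ := v.jump_pos
  have hc0 : 0 < c := lt_of_le_of_lt (by positivity) hc
  obtain ⟨ε, hε, hεJ, hεc⟩ : ∃ ε : ℝ, 0 < ε ∧ 4 * ε ≤ v.jump ∧
      1 < (v.jump - 2 * ε) ^ 2 / (8 * (σ : ℝ) ^ 2) * c := by
    have hcont : Continuous fun ε : ℝ => (v.jump - 2 * ε) ^ 2 / (8 * (σ : ℝ) ^ 2) * c := by
      fun_prop
    have h0 : 1 < (fun ε : ℝ => (v.jump - 2 * ε) ^ 2 / (8 * (σ : ℝ) ^ 2) * c) 0 := by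
      simp only [mul_zero, sub_zero]
      rw [div_lt_iff₀ (by positivity)] at hc
      rw [div_mul_eq_mul_div, one_lt_div (by positivity)]
      linarith
    have h1 : ∀ᶠ ε : ℝ in 𝓝[>] 0, 1 < (v.jump - 2 * ε) ^ 2 / (8 * (σ : ℝ) ^ 2) * c :=
      nhdsWithin_le_nhds (hcont.continuousAt.eventually (lt_mem_nhds h0))
    have h2 : ∀ᶠ ε : ℝ in 𝓝[>] 0, ε ∈ Set.Ioo 0 (v.jump / 4) :=
      Ioo_mem_nhdsGT (by positivity)
    obtain ⟨ε, h3, h4⟩ := (h1.and h2).exists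
    exact ⟨ε, h4.1, by linarith [h4.2], h3⟩
  obtain ⟨t₁, ht₁⟩ := exists_threshold_le v.pos hc0 hεc (((m : ℝ) + 2) * (m + 3)) (m + 2)
  set S := ∑' t : ℕ, ((2 * (m + 1) : ℕ) : ℝ≥0∞) *
    ENNReal.ofReal (Real.exp (-(ε ^ 2 / (2 * (σ : ℝ) ^ 2) * fourthRoot t))) with hS
  refine ⟨(t₁ + 2 : ℕ) + S, ENNReal.add_ne_top.2 ⟨ENNReal.natCast_ne_top _,
    (tsum_law_deviationEvent_lt_top hσ hε).ne⟩, fun δ hδ π hπ => ?_⟩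
  set L := Real.log (1 / δ) with hL
  have hL0 : 0 ≤ L := Real.log_nonneg (by rw [le_div_iff₀ hδ.1]; linarith [hδ.2])
  set T : ℕ := t₁ + 1 + ⌈c * L⌉₊ with hT
  -- Measurable hulls suffice, since only the measures of the deviation events enter.
  let B : ℕ → Set Sample := fun t =>
    toMeasurable (law σ) (deviationEvent π v.mean ε (fourthRoot t))
  have hBm : ∀ t, MeasurableSet (B t) := fun t => measurableSet_toMeasurable _ _
  have hBl : ∀ t, law σ (B t) ≤ (2 * (m + 1) : ℕ) *
      ENNReal.ofReal (Real.exp (-(ε ^ 2 / (2 * (σ : ℝ) ^ 2) * fourthRoot t))) := fun t => by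
    rw [measure_toMeasurable]
    exact law_deviationEvent_le π hσ hε _
  have hind : ∀ t, Measurable ((B t).indicator (1 : Sample → ℝ≥0∞)) := fun t =>
    measurable_one.indicator (hBm t)
  refine ⟨fun ω => T + ∑' t, (B t).indicator 1 ω, measurable_const.add
    (Measurable.tsum hind), fun ω => ?_, ?_⟩
  · refine stopTime_le_of_eventually v ω B T fun t ht hω => ?_
    have hct : c * L ≤ t := (Nat.le_ceil _).trans (by exact_mod_cast (by omega : ⌈c * L⌉₊ ≤ t))
    exact hπ.stopsAt_of_notMem_deviationEvent hσ hδ.1 hδ.2 v hε hεJ (by omega)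
      (fun h => hω (subset_toMeasurable _ _ h)) (ht₁ t (by omega) δ hδ hct)
  · rw [lintegral_add_left measurable_const, lintegral_const, measure_univ, mul_one,
      lintegral_tsum fun t => (hind t).aemeasurable]
    have hTle : (T : ℝ≥0∞) ≤ ENNReal.ofReal (c * L) + (t₁ + 2 : ℕ) := by
      rw [← ENNReal.ofReal_natCast, ← ENNReal.ofReal_natCast,
        ← ENNReal.ofReal_add (by positivity) (by positivity)]
      refine ENNReal.ofReal_le_ofReal ?_
      rw [hT]
      push_cast
      linarith [Nat.ceil_lt_add_one (mul_nonneg hc0.le hL0)]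
    rw [← add_assoc]
    refine add_le_add hTle (ENNReal.tsum_le_tsum fun t => ?_)
    rw [lintegral_indicator_one (hBm t)]
    exact hBl t

/-- A majorant with finite integral is finite almost surely; any constant above 8σ² / Δ² would do.
-/
theorem IsCPI.law_stopTime_lt_top (hπ : IsCPI σ δ π) (hσ : 0 < σ) (hδ : δ ∈ Set.Ioo (0 : ℝ) 1)
    (v : Env m) : law σ {ω | π.stopTime v ω < ⊤} = 1 := by
  obtain ⟨C, hC, h⟩ := exists_stopTime_le hσ v (lt_add_one (8 * (σ : ℝ) ^ 2 / v.jump ^ 2))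
  obtain ⟨G, hG, hle, hint⟩ := h δ hδ π hπ
  have hfin : ∀ᵐ ω ∂law σ, G ω < ⊤ := ae_lt_top hG
    (ne_top_of_le_ne_top (ENNReal.add_ne_top.2 ⟨ENNReal.ofReal_ne_top, hC⟩) hint)
  have hae : ∀ᵐ ω ∂law σ, π.stopTime v ω < ⊤ := by
    filter_upwards [hfin] with ω hω
    have h1 := (hle ω).trans_lt hω
    rw [lt_top_iff_ne_top] at h1 ⊢
    rintro h2
    exact h1 (by simp [h2])
  rw [measure_congr (eventuallyEq_univ.2 hae), measure_univ]

theorem IsCPI.isExact (hπ : IsCPI σ δ π) (hσ : 0 < σ) (hδ : δ ∈ Set.Ioo (0 : ℝ) 1) :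
    π.IsExact σ δ := fun v =>
  have h := hπ.law_stopTime_lt_top hσ hδ v
  ⟨hπ.lt_law_correct hσ hδ.1 hδ.2 v h, h⟩

theorem tendsto_log_one_div : Tendsto (fun δ : ℝ => Real.log (1 / δ)) (𝓝[>] 0) atTop := by
  simp only [one_div]
  exact Real.tendsto_log_atTop.comp tendsto_inv_nhdsGT_zero

/-- The asymptotic upper bound for the expected stopping time of CPI. -/
theorem limsup_expectedTime_le (hσ : 0 < σ) (v : Env m) {cpi : ℝ → Policy m}
    (hcpi : ∀ δ ∈ Set.Ioo (0 : ℝ) 1, IsCPI σ δ (cpi δ)) :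
    limsup (fun δ : ℝ => (cpi δ).expectedTime σ v / ENNReal.ofReal (Real.log (1 / δ))) (𝓝[>] 0)
      ≤ ENNReal.ofReal (8 * (σ : ℝ) ^ 2 / v.jump ^ 2) := by
  have key : ∀ c : ℝ, 8 * (σ : ℝ) ^ 2 / v.jump ^ 2 < c →
      limsup (fun δ : ℝ => (cpi δ).expectedTime σ v / ENNReal.ofReal (Real.log (1 / δ)))
        (𝓝[>] 0) ≤ ENNReal.ofReal c := by
    intro c hc
    have hc0 : 0 ≤ c := le_trans (by positivity) hc.le
    obtain ⟨C, hC, h⟩ := exists_stopTime_le hσ v hc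
    have hlim : Tendsto (fun δ : ℝ => ENNReal.ofReal c + C / ENNReal.ofReal (Real.log (1 / δ)))
        (𝓝[>] 0) (𝓝 (ENNReal.ofReal c)) := by
      have h1 : Tendsto (fun δ : ℝ => C / ENNReal.ofReal (Real.log (1 / δ))) (𝓝[>] 0) (𝓝 0) := by
        have h2 := ENNReal.Tendsto.const_div (a := C)
          (ENNReal.tendsto_ofReal_atTop.comp tendsto_log_one_div) (Or.inr hC)
        simpa using h2
      simpa using tendsto_const_nhds.add h1
    refine (limsup_le_limsup ?_).trans_eq hlim.limsup_eq
    have hmem : Set.Ioo (0 : ℝ) 1 ∈ 𝓝[>] (0 : ℝ) := Ioo_mem_nhdsGT one_pos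
    filter_upwards [hmem] with δ hδ
    obtain ⟨G, -, hle, hint⟩ := h δ hδ _ (hcpi δ hδ)
    have hL : 0 < Real.log (1 / δ) := Real.log_pos (by rw [lt_div_iff₀ hδ.1]; linarith [hδ.2])
    rw [ENNReal.div_le_iff (by simpa using hL) ENNReal.ofReal_ne_top, add_mul,
      ENNReal.div_mul_cancel (by simpa using hL) ENNReal.ofReal_ne_top,
      ← ENNReal.ofReal_mul hc0]
    exact (lintegral_mono hle).trans hint
  refine le_of_forall_gt_imp_ge_of_dense fun x hx => ?_
  obtain ⟨c, hc, hcx⟩ := ENNReal.lt_iff_exists_nnreal_btwn.1 hx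
  refine (key c ?_).trans (by simpa using hcx.le)
  rw [← ENNReal.ofReal_coe_nnreal] at hc
  exact (ENNReal.ofReal_lt_ofReal_iff_of_nonneg (by positivity)).1 hc

end

/-! ### Gaussian divergence and the characteristic time. -/

section

section Gaussian

/-- The log-likelihood ratio of `N(a, v)` and `N(b, v)`. -/
noncomputable def gaussianLLR (a b : ℝ) (v : ℝ≥0) (x : ℝ) : ℝ :=
  ((x - b) ^ 2 - (x - a) ^ 2) / (2 * v)

theorem measurable_gaussianLLR (a b : ℝ) (v : ℝ≥0) : Measurable (gaussianLLR a b v) := by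
  unfold gaussianLLR
  fun_prop

theorem gaussianReal_eq_withDensity (a b : ℝ) {v : ℝ≥0} (hv : v ≠ 0) :
    gaussianReal a v = (gaussianReal b v).withDensity
      fun x => ENNReal.ofReal (Real.exp (gaussianLLR a b v x)) := by
  have hv' : (v : ℝ) ≠ 0 := by exact_mod_cast hv
  rw [gaussianReal_of_var_ne_zero _ hv, gaussianReal_of_var_ne_zero _ hv,
    ← withDensity_mul _ (measurable_gaussianPDF _ _)
      (measurable_gaussianLLR a b v).exp.ennreal_ofReal]
  congr 1
  funext x
  rw [Pi.mul_apply, gaussianPDF, gaussianPDF, ← ENNReal.ofReal_mul (gaussianPDFReal_nonneg _ _ _),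
    gaussianPDFReal, gaussianPDFReal, mul_assoc (_⁻¹), ← Real.exp_add]
  congr 3
  rw [gaussianLLR]
  field_simp
  ring

/-- The Kullback-Leibler divergence of Gaussian measures with equal variances. -/
theorem klDiv_gaussianReal (a b : ℝ) {v : ℝ≥0} (hv : v ≠ 0) :
    InformationTheory.klDiv (gaussianReal a v) (gaussianReal b v) =
      ENNReal.ofReal ((a - b) ^ 2 / (2 * v)) := by
  have hv' : (v : ℝ) ≠ 0 := by exact_mod_cast hv
  have hac : gaussianReal a v ≪ gaussianReal b v := by
    rw [gaussianReal_eq_withDensity a b hv]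
    exact withDensity_absolutelyContinuous _ _
  have hllr : llr (gaussianReal a v) (gaussianReal b v) =ᵐ[gaussianReal a v]
      gaussianLLR a b v := by
    have h := Measure.rnDeriv_withDensity (gaussianReal b v)
      (measurable_gaussianLLR a b v).exp.ennreal_ofReal
    rw [← gaussianReal_eq_withDensity a b hv] at h
    filter_upwards [hac.ae_le h] with x hx
    rw [llr, hx, ENNReal.toReal_ofReal (Real.exp_pos _).le, Real.log_exp]
  have hlin : gaussianLLR a b v = fun x => (a - b) / v * x + (b ^ 2 - a ^ 2) / (2 * v) := by
    funext x
    rw [gaussianLLR]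
    field_simp
    ring
  have hid : Integrable (fun x : ℝ => x) (gaussianReal a v) :=
    (memLp_id_gaussianReal 1).integrable le_rfl
  have hint : Integrable (gaussianLLR a b v) (gaussianReal a v) := by
    rw [hlin]
    exact (hid.const_mul _).add (integrable_const _)
  rw [InformationTheory.klDiv_of_ac_of_integrable hac (hint.congr hllr.symm),
    integral_congr_ae hllr, hlin, integral_add (hid.const_mul _) (integrable_const _),
    integral_const_mul, integral_id_gaussianReal]
  simp only [integral_const, probReal_univ, one_smul, add_sub_cancel_right]
  congr 1
  field_simp
  ring

end Gaussian

variable {m : ℕ} {σ : ℝ≥0}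

namespace Env

/-- The environment with mean `p` up to position `x` and mean `q` after it. -/
noncomputable def step (x : Fin m) {p q : ℝ} (hpq : p ≠ q) : Env m where
  mean i := if i ≤ x.castSucc then p else q
  cp := x
  changePoints_eq := by
    ext i
    simp only [changePoints, Set.mem_ofPred_eq, Set.mem_singleton_iff, Fin.le_def,
      Fin.val_castSucc, Fin.val_succ]
    constructor
    · intro h
      by_contra hne
      have : (i : ℕ) ≠ x := fun h => hne (Fin.ext h)
      refine h ?_
      by_cases h1 : (i : ℕ) ≤ x
      · rw [if_pos h1, if_pos (by omega)]
      · rw [if_neg h1, if_neg (by omega)]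
    · rintro rfl
      simpa using hpq

variable (v : Env m)

/-- The means are constant on both sides of the only change, by induction along the arms. -/
theorem mean_eq_ite (i : Fin (m + 1)) :
    v.mean i = if i ≤ v.cp.castSucc then v.mean v.cp.castSucc else v.mean v.cp.succ := by
  have key : ∀ i : Fin (m + 1), (i ≤ v.cp.castSucc → v.mean i = v.mean 0) ∧
      (v.cp.castSucc < i → v.mean i = v.mean v.cp.succ) := by
    intro i
    induction i using Fin.induction with
    | zero => exact ⟨fun _ => rfl, fun h => absurd h (by simp)⟩
    | succ i ih =>
      simp only [Fin.le_def, Fin.lt_def, Fin.val_castSucc, Fin.val_succ] at ih ⊢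
      constructor
      · intro h
        rw [← v.mean_eq (i := i) (fun he => by rw [he] at h; omega)]
        exact ih.1 (by omega)
      · intro h
        by_cases he : i = v.cp
        · rw [he]
        · have : (i : ℕ) ≠ v.cp := fun h => he (Fin.ext h)
          rw [← v.mean_eq he]
          exact ih.2 (by omega)
  split_ifs with h
  · rw [(key i).1 h, (key v.cp.castSucc).1 le_rfl]
  · exact (key i).2 (not_le.1 h)

/-- For `K ≥ 3` some environment with another change point has all its means within `Δ / 2`. -/
theorem exists_near (hm : 2 ≤ m) :
    ∃ v' : Env m, v'.cp ≠ v.cp ∧ ∀ i, |v.mean i - v'.mean i| ≤ v.jump / 2 := by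
  have hJ := v.jump_pos
  set a := v.mean v.cp.castSucc with ha
  set b := v.mean v.cp.succ with hb
  have hab : a ≠ b := fun h => by
    rw [Env.jump, ← ha, ← hb, h, sub_self, abs_zero] at hJ
    exact lt_irrefl _ hJ
  have hJd : v.jump = |a - b| := rfl
  have h1 : |a - (a + b) / 2| = v.jump / 2 := by
    rw [show a - (a + b) / 2 = (a - b) / 2 by ring, abs_div, abs_two, hJd]
  have h2 : |b - (a + b) / 2| = v.jump / 2 := by
    rw [show b - (a + b) / 2 = -((a - b) / 2) by ring, abs_neg, abs_div, abs_two, hJd]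
  obtain ⟨x, hx⟩ : ∃ x : Fin m, x ≠ v.cp := by
    have : Nontrivial (Fin m) := Fin.nontrivial_iff_two_le.2 hm
    exact exists_ne v.cp
  rcases lt_or_gt_of_ne hx with hlt | hlt
  -- Keep the old value on the side of x away from the old change and use the midpoint of a and b on
  -- the other, where both old values occur.
  · refine ⟨step x (p := a) (q := (a + b) / 2) fun h => hab (by linarith), hx, fun i => ?_⟩
    rw [v.mean_eq_ite i]
    simp only [step, Fin.le_def, Fin.val_castSucc]
    rw [Fin.lt_def] at hlt
    by_cases hi : (i : ℕ) ≤ x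
    · rw [if_pos hi, if_pos (by omega), ← ha, sub_self, abs_zero]
      linarith
    · rw [if_neg hi]
      split_ifs
      · exact h1.le
      · exact h2.le
  · refine ⟨step x (p := (a + b) / 2) (q := b) fun h => hab (by linarith), hx, fun i => ?_⟩
    rw [v.mean_eq_ite i]
    simp only [step, Fin.le_def, Fin.val_castSucc]
    have hlt' : (v.cp : ℕ) < x := hlt
    by_cases hi : (i : ℕ) ≤ x
    · rw [if_pos hi]
      split_ifs
      · exact h1.le
      · exact h2.le
    · rw [if_neg hi, if_neg (by omega), ← hb, sub_self, abs_zero]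
      linarith

end Env

section CharTime

theorem sum_klDiv_eq (hσ : 0 < σ) {α : Fin (m + 1) → ℝ} (hα : ∀ i, 0 ≤ α i)
    (μ ν : Fin (m + 1) → ℝ) :
    ∑ i, ENNReal.ofReal (α i) *
      InformationTheory.klDiv (gaussianReal (μ i) (σ ^ 2)) (gaussianReal (ν i) (σ ^ 2)) =
      ENNReal.ofReal (∑ i, α i * ((μ i - ν i) ^ 2 / (2 * (σ : ℝ) ^ 2))) := by
  rw [ENNReal.ofReal_sum_of_nonneg fun i _ => mul_nonneg (hα i) (by positivity)]
  refine Finset.sum_congr rfl fun i _ => ?_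
  rw [klDiv_gaussianReal _ _ (by positivity), ← ENNReal.ofReal_mul (hα i), NNReal.coe_pow]

/-- Upper bound: the near alternative costs at most Δ² / (8σ²) on each arm, hence under any
proportions. Lower bound: put half the weight on each arm at the change; an alternative gives both
the same mean z, and the cost is smallest when z is their midpoint. -/
theorem invCharTime_eq (hσ : 0 < σ) (hm : 2 ≤ m) (v : Env m) :
    invCharTime σ v = ENNReal.ofReal (v.jump ^ 2 / (8 * (σ : ℝ) ^ 2)) := by
  have hσ' : (0 : ℝ) < σ := hσ
  refine le_antisymm ?_ ?_
  · refine iSup₂_le fun α hα => ?_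
    obtain ⟨v', hv', hd⟩ := v.exists_near hm
    refine (iInf₂_le v' hv').trans ?_
    rw [sum_klDiv_eq hσ hα.1]
    refine ENNReal.ofReal_le_ofReal ?_
    calc ∑ i, α i * ((v.mean i - v'.mean i) ^ 2 / (2 * (σ : ℝ) ^ 2))
        ≤ ∑ i, α i * (v.jump ^ 2 / (8 * (σ : ℝ) ^ 2)) := by
          refine Finset.sum_le_sum fun i _ => mul_le_mul_of_nonneg_left ?_ (hα.1 i)
          have h1 : (v.mean i - v'.mean i) ^ 2 ≤ (v.jump / 2) ^ 2 := by
            rw [← sq_abs]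
            exact pow_le_pow_left₀ (abs_nonneg _) (hd i) 2
          calc _ ≤ (v.jump / 2) ^ 2 / (2 * (σ : ℝ) ^ 2) := by gcongr
            _ = _ := by ring
      _ = _ := by rw [← Finset.sum_mul, hα.2, one_mul]
  · set a := v.cp.castSucc with ha
    set b := v.cp.succ with hb
    have hab : a ≠ b := (Fin.castSucc_lt_succ).ne
    let α : Fin (m + 1) → ℝ := fun i => if i ∈ ({a, b} : Finset (Fin (m + 1))) then 1 / 2 else 0
    have hsum : ∀ f : Fin (m + 1) → ℝ, ∑ i, α i * f i = (f a + f b) / 2 := fun f => by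
      simp only [α, ite_mul, zero_mul]
      rw [Finset.sum_ite_mem, Finset.univ_inter, Finset.sum_pair hab]
      ring
    have hα0 : ∀ i, 0 ≤ α i := fun i => by
      simp only [α]
      split_ifs <;> norm_num
    have hα : α ∈ stdSimplex ℝ (Fin (m + 1)) := by
      refine ⟨hα0, ?_⟩
      have := hsum fun _ => 1
      simpa using this
    refine le_trans ?_ (le_iSup₂ (f := fun α (_ : α ∈ stdSimplex ℝ (Fin (m + 1))) =>
      ⨅ (v' : Env m) (_ : v'.cp ≠ v.cp), ∑ i, ENNReal.ofReal (α i) *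
      InformationTheory.klDiv (gaussianReal (v.mean i) (σ ^ 2)) (gaussianReal (v'.mean i) (σ ^ 2)))
      α hα)
    refine le_iInf₂ fun v' hv' => ?_
    rw [sum_klDiv_eq hσ hα0, hsum, v'.mean_eq (i := v.cp) hv'.symm]
    refine ENNReal.ofReal_le_ofReal ?_
    have hJ : v.jump ^ 2 = (v.mean a - v.mean b) ^ 2 := sq_abs _
    rw [hJ]
    generalize v.mean a = x
    generalize v.mean b = y
    generalize v'.mean b = z
    have : ((x - z) ^ 2 / (2 * (σ : ℝ) ^ 2) + (y - z) ^ 2 / (2 * (σ : ℝ) ^ 2)) / 2 -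
        (x - y) ^ 2 / (8 * (σ : ℝ) ^ 2) = (x + y - 2 * z) ^ 2 / (8 * (σ : ℝ) ^ 2) := by
      field_simp
      ring
    have h2 : 0 ≤ (x + y - 2 * z) ^ 2 / (8 * (σ : ℝ) ^ 2) := by positivity
    linarith

theorem charTime_eq (hσ : 0 < σ) (hm : 2 ≤ m) (v : Env m) :
    charTime σ v = ENNReal.ofReal (8 * (σ : ℝ) ^ 2 / v.jump ^ 2) := by
  have hσ' : (0 : ℝ) < σ := hσ
  have := v.jump_pos
  rw [charTime, invCharTime_eq hσ hm, ← ENNReal.ofReal_inv_of_pos (by positivity), inv_div]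

end CharTime

end

section

variable {m : ℕ} {σ : ℝ≥0}

/-! ### Likelihood ratios of histories. -/

section ChangeOfMeasure

/-- The log-likelihood ratio of the mean rewards `μ` and `ν`, given the history. -/
noncomputable def histLLR (σ : ℝ≥0) (μ ν : Fin (m + 1) → ℝ) {t : ℕ} (h : Hist m t) : ℝ :=
  ∑ i, ((μ i - ν i) * noiseSum μ h i / (σ : ℝ) ^ 2 +
    pulls h i * ((μ i - ν i) ^ 2 / (2 * (σ : ℝ) ^ 2)))

theorem measurable_histLLR (μ ν : Fin (m + 1) → ℝ) (t : ℕ) :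
    Measurable fun h : Hist m t => histLLR σ μ ν h := by
  refine Finset.measurable_sum _ fun i _ => Measurable.add ?_ ?_
  · exact ((measurable_noiseSum μ i).const_mul _).div_const _
  · exact (measurable_from_top.comp (measurable_pulls i)).mul_const _

theorem histLLR_snoc (hσ : 0 < σ) (μ ν : Fin (m + 1) → ℝ) {t : ℕ} (h : Hist m t)
    (p : Fin (m + 1) × ℝ) :
    histLLR σ μ ν (Fin.snoc (α := fun _ => Fin (m + 1) × ℝ) h p : Hist m (t + 1)) =
      histLLR σ μ ν h + gaussianLLR (μ p.1) (ν p.1) (σ ^ 2) p.2 := by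
  have hσ' : (σ : ℝ) ≠ 0 := by exact_mod_cast hσ.ne'
  have key : ∀ i, (μ i - ν i) * noiseSum μ
        (Fin.snoc (α := fun _ => Fin (m + 1) × ℝ) h p : Hist m (t + 1)) i / (σ : ℝ) ^ 2 +
      pulls (Fin.snoc (α := fun _ => Fin (m + 1) × ℝ) h p : Hist m (t + 1)) i *
        ((μ i - ν i) ^ 2 / (2 * (σ : ℝ) ^ 2)) =
      ((μ i - ν i) * noiseSum μ h i / (σ : ℝ) ^ 2 +
        pulls h i * ((μ i - ν i) ^ 2 / (2 * (σ : ℝ) ^ 2))) +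
      if p.1 = i then gaussianLLR (μ i) (ν i) (σ ^ 2) p.2 else 0 := fun i => by
    rw [pulls_snoc, noiseSum_snoc]
    split_ifs
    · rw [gaussianLLR]
      push_cast
      field_simp
      ring
    · simp
  rw [histLLR, Finset.sum_congr rfl fun i _ => key i, Finset.sum_add_distrib, histLLR]
  simp

/-- One round of the change of measure: the reward law with mean a has density exp (`gaussianLLR`)
with respect to that with mean b. -/
theorem lintegral_noise_shift (hσ : 0 < σ) (a b : ℝ) {f : ℝ → ℝ≥0∞} (hf : Measurable f) :
    ∫⁻ x, f (a + x) ∂noiseLaw σ =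
      ∫⁻ x, f (b + x) * ENNReal.ofReal (Real.exp (gaussianLLR a b (σ ^ 2) (b + x)))
        ∂noiseLaw σ := by
  have hmap : ∀ c : ℝ, (noiseLaw σ).map (c + ·) = gaussianReal c (σ ^ 2) := fun c => by
    rw [noiseLaw, gaussianReal_map_const_add, zero_add]
  have hw := (measurable_gaussianLLR a b (σ ^ 2)).exp.ennreal_ofReal
  rw [← lintegral_map (μ := noiseLaw σ) (g := (a + ·)) hf (measurable_const_add a),
    ← lintegral_map (μ := noiseLaw σ) (g := (b + ·)) (f := fun y => f y *
      ENNReal.ofReal (Real.exp (gaussianLLR a b (σ ^ 2) y))) (hf.mul hw) (measurable_const_add b),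
    hmap, hmap, gaussianReal_eq_withDensity a b (by positivity),
    lintegral_withDensity_eq_lintegral_mul _ hw hf]
  simp only [Pi.mul_apply, mul_comm]

/-- Change of measure between two vectors of mean rewards. -/
theorem lintegral_history_change (hσ : 0 < σ) (π : Policy m) (μ ν : Fin (m + 1) → ℝ) (t : ℕ)
    {g : unitInterval × Hist m t → ℝ≥0∞} (hg : Measurable g) :
    ∫⁻ ω, g (ω.1, π.history μ ω t) ∂law σ =
      ∫⁻ ω, g (ω.1, π.history ν ω t) *
        ENNReal.ofReal (Real.exp (histLLR σ μ ν (π.history ν ω t))) ∂law σ := by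
  induction t with
  | zero =>
    refine lintegral_congr fun ω => ?_
    have : histLLR σ μ ν (π.history ν ω 0) = 0 := by simp [histLLR]
    rw [this, Real.exp_zero, ENNReal.ofReal_one, mul_one, Policy.history, Policy.history]
  | succ t ih =>
    have hact : Measurable fun p : (unitInterval × Hist m t) × ℝ => π.act t p.1.1 p.1.2 :=
      (π.measurable_act t).comp
        (by fun_prop : Measurable fun p : (unitInterval × Hist m t) × ℝ => (p.1.1, p.1.2))
    have hμ : Measurable fun p : (unitInterval × Hist m t) × ℝ => μ (π.act t p.1.1 p.1.2) :=
      (measurable_of_finite μ).comp hact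
    let G : unitInterval × Hist m t → ℝ≥0∞ := fun p => ∫⁻ x, g (p.1,
      Fin.snoc (α := fun _ => Fin (m + 1) × ℝ) p.2
        (π.act t p.1 p.2, μ (π.act t p.1 p.2) + x)) ∂noiseLaw σ
    have hG : Measurable G := by
      refine Measurable.lintegral_prod_right' (f := fun p : (unitInterval × Hist m t) × ℝ =>
        g (p.1.1, Fin.snoc (α := fun _ => Fin (m + 1) × ℝ) p.1.2
        (π.act t p.1.1 p.1.2, μ (π.act t p.1.1 p.1.2) + p.2))) ?_
      refine hg.comp ((by fun_prop : Measurable fun p : (unitInterval × Hist m t) × ℝ =>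
        p.1.1).prodMk ((measurable_snoc t).comp
          (f := fun p : (unitInterval × Hist m t) × ℝ => (p.1.2, _)) ?_))
      exact (by fun_prop : Measurable fun p : (unitInterval × Hist m t) × ℝ => p.1.2).prodMk
        (hact.prodMk (hμ.add measurable_snd))
    rw [lintegral_history_succ π μ σ t hg,
      lintegral_history_succ π ν σ t (F := fun p => g p *
        ENNReal.ofReal (Real.exp (histLLR σ μ ν p.2)))
        (hg.mul ((measurable_histLLR μ ν _).comp measurable_snd).exp.ennreal_ofReal)]
    refine (ih hG).trans (lintegral_congr fun ω => ?_)
    have hgm : Measurable fun y => g (ω.1, Fin.snoc (α := fun _ => Fin (m + 1) × ℝ)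
        (π.history ν ω t) (π.act t ω.1 (π.history ν ω t), y)) :=
      hg.comp (measurable_const.prodMk ((measurable_snoc t).comp
        (f := fun y : ℝ => (π.history ν ω t, (π.act t ω.1 (π.history ν ω t), y)))
        (measurable_const.prodMk (measurable_const.prodMk measurable_id))))
    simp only [G]
    rw [lintegral_noise_shift hσ (μ (π.act t ω.1 (π.history ν ω t)))
      (ν (π.act t ω.1 (π.history ν ω t))) hgm, ← lintegral_mul_const' _ _ ENNReal.ofReal_ne_top]
    refine lintegral_congr fun x => ?_
    rw [histLLR_snoc hσ, Real.exp_add, ENNReal.ofReal_mul (Real.exp_pos _).le]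
    ring

/-- If the means of `ν` are within `√(2 σ² κ)` of those of `μ`, the log-likelihood ratio is
unlikely to exceed `(1 + 2 q) κ t`. -/
theorem law_histLLR_gt_le (π : Policy m) {μ ν : Fin (m + 1) → ℝ} (hσ : 0 < σ) {κ q : ℝ}
    (hq : 0 < q) (hd : ∀ i, (μ i - ν i) ^ 2 / (2 * (σ : ℝ) ^ 2) ≤ κ) (t : ℕ) :
    law σ {ω | (1 + 2 * q) * κ * t < histLLR σ μ ν (π.history μ ω t)} ≤
      ENNReal.ofReal (Real.exp (-(q ^ 2 * κ * t))) := by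
  have hσ' : (σ : ℝ) ≠ 0 := by exact_mod_cast hσ.ne'
  -- This tilt makes the exponent q · LLR - (q + q²) · I, where I ≤ κ t is the accumulated
  -- divergence; on the event it exceeds q (1 + 2q) κ t - (q + q²) κ t = q² κ t.
  have hF := IsSupermart.prod (σ := σ) (μ := μ)
    (ψ := fun i => expWeight σ (q * (μ i - ν i) / (σ : ℝ) ^ 2))
    (fun i n => measurable_expWeight _ n) (fun i n s => (lintegral_expWeight _ n s).le)
  have hv := hF.ville (fun h => by simp [expWeight]) π
    (ENNReal.ofReal (Real.exp (q ^ 2 * κ * t)))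
  rw [← ENNReal.ofReal_inv_of_pos (Real.exp_pos _), ← Real.exp_neg] at hv
  refine (measure_mono fun ω hω => ?_).trans hv
  refine ⟨t, ?_⟩
  have hω' : (1 + 2 * q) * κ * t < histLLR σ μ ν (π.history μ ω t) := hω
  simp only [expWeight]
  rw [← ENNReal.ofReal_prod_of_nonneg fun i _ => (Real.exp_pos _).le, ← Real.exp_sum]
  refine ENNReal.ofReal_le_ofReal (Real.exp_le_exp.2 ?_)
  set h := π.history μ ω t
  have hκ : ∑ i, (pulls h i : ℝ) * ((μ i - ν i) ^ 2 / (2 * (σ : ℝ) ^ 2)) ≤ κ * t := by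
    calc _ ≤ ∑ i, (pulls h i : ℝ) * κ :=
          Finset.sum_le_sum fun i _ => mul_le_mul_of_nonneg_left (hd i) (Nat.cast_nonneg _)
      _ = _ := by
          rw [← Finset.sum_mul, mul_comm]
          congr 1
          exact_mod_cast sum_pulls h
  have hsplit : ∑ i, (q * (μ i - ν i) / (σ : ℝ) ^ 2 * noiseSum μ h i -
      pulls h i * ((q * (μ i - ν i) / (σ : ℝ) ^ 2) ^ 2 * (σ : ℝ) ^ 2 / 2)) =
      q * histLLR σ μ ν h -
        (q + q ^ 2) * ∑ i, (pulls h i : ℝ) * ((μ i - ν i) ^ 2 / (2 * (σ : ℝ) ^ 2)) := by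
    rw [histLLR, Finset.mul_sum, Finset.mul_sum, ← Finset.sum_sub_distrib]
    refine Finset.sum_congr rfl fun i _ => ?_
    field_simp
    ring
  rw [hsplit]
  have h1 := mul_lt_mul_of_pos_left hω' hq
  have h2 := mul_le_mul_of_nonneg_left hκ (by positivity : 0 ≤ q + q ^ 2)
  linarith

/-- Where the log-likelihood ratio is at most (1 + 2q) κ t, changing measure costs at most its
exponential; the rest has small probability under μ. -/
theorem law_history_mem_le (hσ : 0 < σ) (π : Policy m) {μ ν : Fin (m + 1) → ℝ} {κ q : ℝ}
    (hq : 0 < q) (hd : ∀ i, (μ i - ν i) ^ 2 / (2 * (σ : ℝ) ^ 2) ≤ κ) (t : ℕ)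
    {R : Set (unitInterval × Hist m t)} (hR : MeasurableSet R) :
    law σ {ω | (ω.1, π.history μ ω t) ∈ R} ≤
      ENNReal.ofReal (Real.exp ((1 + 2 * q) * κ * t)) * law σ {ω | (ω.1, π.history ν ω t) ∈ R} +
        ENNReal.ofReal (Real.exp (-(q ^ 2 * κ * t))) := by
  set x := (1 + 2 * q) * κ * t
  let Q : Set (unitInterval × Hist m t) := R ∩ {p | histLLR σ μ ν p.2 ≤ x}
  have hQ : MeasurableSet Q := hR.inter
    (measurableSet_le ((measurable_histLLR μ ν t).comp measurable_snd) measurable_const)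
  have hpre : ∀ μ : Fin (m + 1) → ℝ, Measurable fun ω : Sample => (ω.1, π.history μ ω t) :=
    fun μ => measurable_fst.prodMk (measurable_history π μ t)
  have hQle : law σ {ω | (ω.1, π.history μ ω t) ∈ Q} ≤
      ENNReal.ofReal (Real.exp x) * law σ {ω | (ω.1, π.history ν ω t) ∈ R} := by
    calc law σ {ω | (ω.1, π.history μ ω t) ∈ Q}
        = ∫⁻ ω, Q.indicator 1 (ω.1, π.history μ ω t) ∂law σ :=
          (lintegral_indicator_one (hpre μ hQ)).symm
      _ = ∫⁻ ω, Q.indicator 1 (ω.1, π.history ν ω t) *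
            ENNReal.ofReal (Real.exp (histLLR σ μ ν (π.history ν ω t))) ∂law σ :=
          lintegral_history_change hσ π μ ν t (measurable_one.indicator hQ)
      _ ≤ ∫⁻ ω, ENNReal.ofReal (Real.exp x) *
            {ω | (ω.1, π.history ν ω t) ∈ R}.indicator 1 ω ∂law σ := by
          refine lintegral_mono fun ω => ?_
          by_cases hω : (ω.1, π.history ν ω t) ∈ Q
          · rw [Set.indicator_of_mem hω, Set.indicator_of_mem (show ω ∈ {ω : Sample |
              (ω.1, π.history ν ω t) ∈ R} from hω.1)]
            simp only [Pi.one_apply, one_mul, mul_one]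
            exact ENNReal.ofReal_le_ofReal (Real.exp_le_exp.2 hω.2)
          · rw [Set.indicator_of_notMem hω, zero_mul]
            exact zero_le
      _ = _ := by
          have hm : MeasurableSet {ω : Sample | (ω.1, π.history ν ω t) ∈ R} := hpre ν hR
          rw [lintegral_const_mul' _ _ ENNReal.ofReal_ne_top, lintegral_indicator_one hm]
  calc law σ {ω | (ω.1, π.history μ ω t) ∈ R}
      ≤ law σ ({ω | (ω.1, π.history μ ω t) ∈ Q} ∪
          {ω | x < histLLR σ μ ν (π.history μ ω t)}) := by
        refine measure_mono fun ω hω => ?_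
        rcases le_or_gt (histLLR σ μ ν (π.history μ ω t)) x with h | h
        · exact Or.inl ⟨hω, h⟩
        · exact Or.inr h
    _ ≤ _ := (measure_union_le _ _).trans
        (add_le_add hQle (law_histLLR_gt_le π hσ hq hd t))

end ChangeOfMeasure

/-! ### Stopping decisions as events of a history of fixed length. -/

section Truncation

/-- The first `s` rounds of a history. -/
def truncate {t : ℕ} (h : Hist m t) (s : ℕ) : Hist m s :=
  -- The default value is never reached when s ≤ t, the only case that matters.
  fun i => if hi : (i : ℕ) < t then h ⟨i, hi⟩ else (0, 0)

theorem measurable_truncate (t s : ℕ) : Measurable fun h : Hist m t => truncate h s := by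
  refine measurable_pi_iff.2 fun i => ?_
  unfold truncate
  split_ifs with hi
  · exact measurable_pi_apply _
  · exact measurable_const

variable (π : Policy m) (μ : Fin (m + 1) → ℝ) (ω : Sample)

theorem truncate_history {s t : ℕ} (hst : s ≤ t) :
    truncate (π.history μ ω t) s = π.history μ ω s := by
  induction t, hst using Nat.le_induction with
  | base =>
    funext i
    simp [truncate]
  | succ t hst ih =>
    rw [← ih]
    funext i
    have h1 : (i : ℕ) < t := i.2.trans_le hst
    simp only [truncate, h1, h1.trans t.lt_succ_self, dif_pos, Policy.history]
    exact Fin.snoc_castSucc (α := fun _ => Fin (m + 1) × ℝ) _ _ ⟨i, h1⟩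

/-- The policy halts by time `t`, and returns `x`, when it is fed with this seed and history. -/
def haltsWith (t : ℕ) (x : Fin m) : Set (unitInterval × Hist m t) :=
  {p | ∃ s ≤ t, (π.halt s p.1 (truncate p.2 s) ∧ ∀ r < s, ¬ π.halt r p.1 (truncate p.2 r)) ∧
    π.recommend s p.1 (truncate p.2 s) = x}

theorem measurableSet_haltsWith (t : ℕ) (x : Fin m) : MeasurableSet (haltsWith π t x) := by
  have htr : ∀ s, Measurable fun p : unitInterval × Hist m t => (p.1, truncate p.2 s) :=
    fun s => measurable_fst.prodMk ((measurable_truncate t s).comp measurable_snd)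
  have hh : ∀ s, MeasurableSet {p : unitInterval × Hist m t | π.halt s p.1 (truncate p.2 s)} :=
    fun s => htr s (π.measurableSet_halt s)
  have hr : ∀ s, MeasurableSet
      {p : unitInterval × Hist m t | π.recommend s p.1 (truncate p.2 s) = x} := fun s =>
    ((π.measurable_recommend s).comp (htr s)) (measurableSet_singleton x)
  have heq : haltsWith π t x = ⋃ s ∈ Set.Iic t,
      ({p | π.halt s p.1 (truncate p.2 s)} ∩ ⋂ r ∈ Set.Iio s,
        {p | π.halt r p.1 (truncate p.2 r)}ᶜ) ∩ {p | π.recommend s p.1 (truncate p.2 s) = x} := by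
    ext p
    simp [haltsWith, and_left_comm]
  rw [heq]
  exact MeasurableSet.biUnion (Set.to_countable _) fun s _ => ((hh s).inter
    (MeasurableSet.biInter (Set.to_countable _) fun r _ => (hh r).compl)).inter (hr s)

theorem stopTime_eq_iff (v : Env m) (s : ℕ) :
    π.stopTime v ω = s ↔ π.StopsAt v ω s ∧ ∀ r < s, ¬ π.StopsAt v ω r := by
  constructor
  · refine fun h => ⟨Policy.stopsAt_of_stopTime_eq v ω h, fun r hr halted => ?_⟩
    have h1 := Policy.stopTime_le v ω halted
    rw [h] at h1
    exact absurd (by exact_mod_cast h1 : s ≤ r) (not_le.2 hr)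
  · rintro ⟨h1, h2⟩
    refine le_antisymm (Policy.stopTime_le v ω h1) (le_iInf₂ fun r hr => ?_)
    have : s ≤ r := not_lt.1 fun hlt => h2 r hlt hr
    exact_mod_cast this

theorem mem_haltsWith_history_iff (v : Env m) (t : ℕ) (x : Fin m) :
    (ω.1, π.history v.mean ω t) ∈ haltsWith π t x ↔
      ∃ s ≤ t, π.stopTime v ω = s ∧ π.recommend s ω.1 (π.history v.mean ω s) = x := by
  refine exists_congr fun s => and_congr_right fun hs => ?_
  rw [stopTime_eq_iff, truncate_history π v.mean ω hs]
  refine and_congr_left fun _ => and_congr_right fun _ => forall₂_congr fun r hr => ?_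
  rw [truncate_history π v.mean ω (hr.le.trans hs)]
  rfl

end Truncation

/-! ### Lower bound for exact policies. -/

section LowerBound

variable {π : Policy m}

theorem measurableSet_stopsBy (v : Env m) (T : ℕ) :
    MeasurableSet {ω : Sample | ∃ s ≤ T, π.StopsAt v ω s} := by
  have h : ∀ s, MeasurableSet {ω : Sample | π.StopsAt v ω s} := fun s =>
    (measurable_fst.prodMk (measurable_history π v.mean s)) (π.measurableSet_halt s)
  have heq : {ω : Sample | ∃ s ≤ T, π.StopsAt v ω s} =
      ⋃ s ∈ Set.Iic T, {ω | π.StopsAt v ω s} := by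
    ext ω
    simp
  rw [heq]
  exact MeasurableSet.biUnion (Set.to_countable _) fun s _ => h s

/-- Markov's inequality: without a halt by time T, the stopping time is at least T. -/
theorem mul_law_not_stopsBy_le (v : Env m) (T : ℕ) :
    T * law σ {ω | ∃ s ≤ T, π.StopsAt v ω s}ᶜ ≤ π.expectedTime σ v := by
  rw [← lintegral_indicator_const (measurableSet_stopsBy v T).compl]
  refine lintegral_mono fun ω => ?_
  by_cases hω : ∃ s ≤ T, π.StopsAt v ω s
  · rw [Set.indicator_of_notMem (by simpa using hω)]
    exact zero_le
  · rw [Set.indicator_of_mem hω]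
    have : (T : ℕ∞) ≤ π.stopTime v ω := le_iInf₂ fun s hs => by
      have : T ≤ s := not_lt.1 fun hlt => hω ⟨s, hlt.le, hs⟩
      exact_mod_cast this
    simpa using ENat.toENNReal_le.2 this

/-- Nonasymptotic lower bound for the expected stopping time of an exact policy. -/
theorem mul_ofReal_le_expectedTime (hσ : 0 < σ) {δ : ℝ} (hδ : δ ∈ Set.Ioo (0 : ℝ) 1)
    (hπ : π.IsExact σ δ) {v v' : Env m} (hv : v'.cp ≠ v.cp) {κ q : ℝ} (hq : 0 < q)
    (hd : ∀ i, (v.mean i - v'.mean i) ^ 2 / (2 * (σ : ℝ) ^ 2) ≤ κ) (T : ℕ) :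
    T * ENNReal.ofReal (1 - δ -
      (Real.exp ((1 + 2 * q) * κ * T) * δ + Real.exp (-(q ^ 2 * κ * T)))) ≤
      π.expectedTime σ v := by
  refine le_trans ?_ (mul_law_not_stopsBy_le v T)
  gcongr
  set A := {ω | ∃ t : ℕ, π.stopTime v ω = t ∧ π.recommend t ω.1 (π.history v.mean ω t) = v.cp}
  set A' := {ω | ∃ t : ℕ, π.stopTime v' ω = t ∧
    π.recommend t ω.1 (π.history v'.mean ω t) = v'.cp}
  have hA : ENNReal.ofReal (1 - δ) < law σ A := (hπ v).1
  have hA' : ENNReal.ofReal (1 - δ) < law σ A' := (hπ v').1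
  have hR := measurableSet_haltsWith π T v.cp
  have hwrong : law σ {ω | (ω.1, π.history v'.mean ω T) ∈ haltsWith π T v.cp} ≤
      ENNReal.ofReal δ := by
    have hmeas : MeasurableSet {ω : Sample | (ω.1, π.history v'.mean ω T) ∈ haltsWith π T v.cp} :=
      (measurable_fst.prodMk (measurable_history π v'.mean T)) hR
    -- Returning the change point of v is an error in v', so exactness there bounds its probability
    -- by δ.
    have hdisj : Disjoint A' {ω | (ω.1, π.history v'.mean ω T) ∈ haltsWith π T v.cp} := by
      rw [Set.disjoint_left]
      rintro ω ⟨t, ht, hrec⟩ hω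
      obtain ⟨s, -, hs, hrec'⟩ := (mem_haltsWith_history_iff π ω v' T v.cp).1 hω
      have hts : t = s := by
        rw [ht] at hs
        exact_mod_cast hs
      subst hts
      exact hv (hrec.symm.trans hrec')
    have h1 : law σ A' + law σ {ω | (ω.1, π.history v'.mean ω T) ∈ haltsWith π T v.cp} ≤ 1 := by
      rw [← measure_union hdisj hmeas]
      exact prob_le_one
    have h2 : ENNReal.ofReal (1 - δ) +
        law σ {ω | (ω.1, π.history v'.mean ω T) ∈ haltsWith π T v.cp} ≤
        ENNReal.ofReal (1 - δ) + ENNReal.ofReal δ := by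
      rw [← ENNReal.ofReal_add (by linarith [hδ.2]) hδ.1.le, sub_add_cancel, ENNReal.ofReal_one]
      exact (add_le_add_left hA'.le _).trans h1
    exact (ENNReal.add_le_add_iff_left ENNReal.ofReal_ne_top).1 h2
  have hright : law σ {ω | (ω.1, π.history v.mean ω T) ∈ haltsWith π T v.cp} ≤
      ENNReal.ofReal (Real.exp ((1 + 2 * q) * κ * T) * δ + Real.exp (-(q ^ 2 * κ * T))) := by
    refine (law_history_mem_le hσ π hq hd T hR).trans ?_
    rw [ENNReal.ofReal_add (mul_nonneg (Real.exp_pos _).le hδ.1.le) (Real.exp_pos _).le,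
      ENNReal.ofReal_mul (Real.exp_pos _).le]
    gcongr
  rw [ENNReal.ofReal_sub _ (add_nonneg (mul_nonneg (Real.exp_pos _).le hδ.1.le)
    (Real.exp_pos _).le), tsub_le_iff_right]
  calc ENNReal.ofReal (1 - δ) ≤ law σ A := hA.le
    _ ≤ law σ ({ω | ∃ s ≤ T, π.StopsAt v ω s}ᶜ ∪
          {ω | (ω.1, π.history v.mean ω T) ∈ haltsWith π T v.cp}) := by
        refine measure_mono ?_
        rintro ω ⟨t, ht, hrec⟩
        by_cases hω : ∃ s ≤ T, π.StopsAt v ω s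
        · right
          obtain ⟨s, hs, halted⟩ := hω
          refine (mem_haltsWith_history_iff π ω v T v.cp).2 ⟨t, le_trans ?_ hs, ht, hrec⟩
          have := Policy.stopTime_le v ω halted
          rw [ht] at this
          exact_mod_cast this
        · exact Or.inl hω
    _ ≤ _ := (measure_union_le _ _).trans (add_le_add_right hright _)

/-- The asymptotic lower bound for the expected stopping time of exact policies. -/
theorem le_liminf_expectedTime (hσ : 0 < σ) (hm : 2 ≤ m) (v : Env m) {ρ : ℝ → Policy m}
    (hρ : ∀ δ ∈ Set.Ioo (0 : ℝ) 1, (ρ δ).IsExact σ δ) :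
    ENNReal.ofReal (8 * (σ : ℝ) ^ 2 / v.jump ^ 2) ≤
      liminf (fun δ : ℝ => (ρ δ).expectedTime σ v / ENNReal.ofReal (Real.log (1 / δ)))
        (𝓝[>] 0) := by
  have hσ' : (0 : ℝ) < σ := hσ
  have hJ := v.jump_pos
  obtain ⟨v', hv', hnear⟩ := v.exists_near hm
  set κ := v.jump ^ 2 / (8 * (σ : ℝ) ^ 2) with hκ
  have hκ0 : 0 < κ := by positivity
  have hd : ∀ i, (v.mean i - v'.mean i) ^ 2 / (2 * (σ : ℝ) ^ 2) ≤ κ := fun i => by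
    have h1 : (v.mean i - v'.mean i) ^ 2 ≤ (v.jump / 2) ^ 2 := by
      rw [← sq_abs]
      exact pow_le_pow_left₀ (abs_nonneg _) (hnear i) 2
    calc _ ≤ (v.jump / 2) ^ 2 / (2 * (σ : ℝ) ^ 2) := by gcongr
      _ = _ := by rw [hκ]; ring
  have key : ∀ c : ℝ, 0 < c → c < 8 * (σ : ℝ) ^ 2 / v.jump ^ 2 → ENNReal.ofReal c ≤
      liminf (fun δ : ℝ => (ρ δ).expectedTime σ v / ENNReal.ofReal (Real.log (1 / δ)))
        (𝓝[>] 0) := by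
    intro c hc hcκ
    -- Possible as κ c < 1. With T = ⌊c L⌋ and δ = exp (-L) it makes the transferred error at most
    -- exp (-q L).
    obtain ⟨q, hq, hqc⟩ : ∃ q : ℝ, 0 < q ∧ (1 + 2 * q) * κ * c < 1 - q := by
      have hcont : Continuous fun q : ℝ => (1 + 2 * q) * κ * c - (1 - q) := by fun_prop
      have h0 : (fun q : ℝ => (1 + 2 * q) * κ * c - (1 - q)) 0 < 0 := by
        have : κ * c < 1 := by
          rw [lt_div_iff₀ (by positivity)] at hcκ
          rw [hκ, div_mul_eq_mul_div, div_lt_one (by positivity)]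
          linarith
        simp only [mul_zero, add_zero, one_mul, sub_zero]
        linarith
      have h1 : ∀ᶠ q : ℝ in 𝓝[>] 0, (1 + 2 * q) * κ * c - (1 - q) < 0 :=
        nhdsWithin_le_nhds (hcont.continuousAt.eventually (gt_mem_nhds h0))
      obtain ⟨q, h2, h3⟩ := (h1.and self_mem_nhdsWithin).exists
      exact ⟨q, h3, by linarith⟩
    -- The nonasymptotic bound divided by L = log (1/δ): the first factor tends to c and the second
    -- to 1.
    let f : ℝ → ℝ := fun L => (⌊c * L⌋₊ : ℝ) / L *
      (1 - Real.exp (-L) - (Real.exp (-(q * L)) + Real.exp (-(q ^ 2 * κ * ⌊c * L⌋₊))))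
    have hf : Tendsto f atTop (𝓝 c) := by
      have h1 : Tendsto (fun L : ℝ => Real.exp (-L)) atTop (𝓝 0) :=
        Real.tendsto_exp_neg_atTop_nhds_zero
      have h2 : Tendsto (fun L : ℝ => Real.exp (-(q * L))) atTop (𝓝 0) :=
        h1.comp (tendsto_id.const_mul_atTop hq)
      have h3 : Tendsto (fun L : ℝ => Real.exp (-(q ^ 2 * κ * ⌊c * L⌋₊))) atTop (𝓝 0) := by
        refine h1.comp (Tendsto.const_mul_atTop (by positivity) ?_)
        exact tendsto_natCast_atTop_atTop.comp
          (tendsto_nat_floor_atTop.comp (tendsto_id.const_mul_atTop hc))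
      have h4 := (tendsto_nat_floor_mul_div_atTop hc.le).mul
        (((tendsto_const_nhds (x := (1 : ℝ))).sub h1).sub (h2.add h3))
      simpa using h4
    have hlim : Tendsto (fun δ : ℝ => ENNReal.ofReal (f (Real.log (1 / δ)))) (𝓝[>] 0)
        (𝓝 (ENNReal.ofReal c)) :=
      ENNReal.tendsto_ofReal (hf.comp tendsto_log_one_div)
    refine hlim.liminf_eq.symm.trans_le (liminf_le_liminf ?_)
    have hmem : Set.Ioo (0 : ℝ) 1 ∈ 𝓝[>] (0 : ℝ) := Ioo_mem_nhdsGT one_pos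
    filter_upwards [hmem] with δ hδ
    have hL : 0 < Real.log (1 / δ) := Real.log_pos (by rw [lt_div_iff₀ hδ.1]; linarith [hδ.2])
    set L := Real.log (1 / δ) with hLdef
    have hδL : δ = Real.exp (-L) := by
      rw [hLdef, one_div, Real.log_inv, neg_neg, Real.exp_log hδ.1]
    rw [ENNReal.le_div_iff_mul_le (Or.inl (by simpa using hL)) (Or.inl ENNReal.ofReal_ne_top)]
    refine le_trans ?_ (mul_ofReal_le_expectedTime hσ hδ (hρ δ hδ) hv' hq hd ⌊c * L⌋₊)
    rw [← ENNReal.ofReal_mul' hL.le, ← ENNReal.ofReal_natCast,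
      ← ENNReal.ofReal_mul (Nat.cast_nonneg _)]
    refine ENNReal.ofReal_le_ofReal ?_
    have h1 : f L * L = (⌊c * L⌋₊ : ℝ) *
        (1 - Real.exp (-L) - (Real.exp (-(q * L)) + Real.exp (-(q ^ 2 * κ * ⌊c * L⌋₊)))) := by
      simp only [f]
      field_simp
    rw [h1]
    have h2 : Real.exp ((1 + 2 * q) * κ * ⌊c * L⌋₊) * δ ≤ Real.exp (-(q * L)) := by
      rw [hδL, ← Real.exp_add, Real.exp_le_exp]
      have h3 : (⌊c * L⌋₊ : ℝ) ≤ c * L := Nat.floor_le (by positivity)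
      have h4 : (1 + 2 * q) * κ * ⌊c * L⌋₊ ≤ (1 + 2 * q) * κ * (c * L) := by gcongr
      have h5 := mul_lt_mul_of_pos_right hqc hL
      linarith
    refine mul_le_mul_of_nonneg_left ?_ (Nat.cast_nonneg _)
    rw [← hδL]
    linarith
  refine le_of_forall_lt fun x hx => ?_
  obtain ⟨c, hxc, hc⟩ := ENNReal.lt_iff_exists_nnreal_btwn.1 hx
  refine lt_of_lt_of_le hxc ?_
  rw [← ENNReal.ofReal_coe_nnreal] at hc hxc ⊢
  refine key c ?_ ((ENNReal.ofReal_lt_ofReal_iff_of_nonneg c.2).1 hc)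
  exact ENNReal.ofReal_pos.1 ((zero_le).trans_lt hxc)

end LowerBound

end

end ChangePointBandit

open ChangePointBandit in
theorem mainTheorem4 {m : ℕ} (σ : ℝ≥0) (hσ : 0 < σ) (cpi : ℝ → Policy m)
    (hcpi : ∀ δ ∈ Set.Ioo (0 : ℝ) 1, IsCPI σ δ (cpi δ)) :
    -- CPI is an Exact-(1, δ) policy
    (∀ δ ∈ Set.Ioo (0 : ℝ) 1, (cpi δ).IsExact σ δ) ∧
    ∀ v : Env m,
      -- the asymptotic upper bound in explicit form
      limsup (fun δ : ℝ => (cpi δ).expectedTime σ v / ENNReal.ofReal (Real.log (1 / δ))) (𝓝[>] 0)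
          ≤ ENNReal.ofReal (8 * (σ : ℝ) ^ 2 / v.jump ^ 2) ∧
      -- for `K ≥ 3`: the explicit constant is `c*(v)`, and it cannot be improved
      (2 ≤ m →
        charTime σ v = ENNReal.ofReal (8 * (σ : ℝ) ^ 2 / v.jump ^ 2) ∧
        limsup (fun δ : ℝ => (cpi δ).expectedTime σ v / ENNReal.ofReal (Real.log (1 / δ))) (𝓝[>] 0)
          ≤ charTime σ v ∧
        ∀ ρ : ℝ → Policy m, (∀ δ ∈ Set.Ioo (0 : ℝ) 1, (ρ δ).IsExact σ δ) →
          charTime σ v ≤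
            liminf (fun δ : ℝ => (ρ δ).expectedTime σ v / ENNReal.ofReal (Real.log (1 / δ)))
              (𝓝[>] 0)) := by
  refine ⟨fun δ hδ => (hcpi δ hδ).isExact hσ hδ, fun v =>
    ⟨limsup_expectedTime_le hσ v hcpi, fun hm => ?_⟩⟩
  rw [charTime_eq hσ hm v]
  exact ⟨rfl, limsup_expectedTime_le hσ v hcpi, fun ρ hρ => le_liminf_expectedTime hσ hm v hρ⟩
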